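/- Let $\beta>1$ be a real number, let $N$ be the natural number with $N-1<\beta\le N$, and let $\Sigma=\{0,\dots,N-1\}$. Put $f_\beta(x)=\beta x-[\beta x]$ and $d_n(x)=[\beta f_\beta^{n-1}(x)]$ for $x\in[0,1)$, $n\ge 1$; let $\xi_\beta=\sup_{x\in[0,1)}(d_n(x))_{n\ge1}$ in the lexicographic order of $\Sigma^{\mathbb N}$, and let $$X_\beta=\{\omega\in\Sigma^{\mathbb N}\mid \sigma^m(\omega)\le\xi_\beta,\ m=0,1,2,\dots\}$$ be the $\beta$-shift, where $\sigma$ is the shift on $\Sigma^{\mathbb N}$. Let $G_\beta$ be the groupoid underlying the $C^*$-algebra $\mathcal O_\beta$ associated with $X_\beta$, that is, the groupoid of the canonical $\lambda$-graph system of $X_\beta$, constructed as follows. For $l\ge0$ let $V_l$ be the finite set of $l$-past equivalence classes of $X_\beta$, where $x,y\in X_\beta$ are $l$-past equivalent if for every word $\mu$ of length $l$ one has $\mu x\in X_\beta$ if and only if $\mu y\in X_\beta$. There is an edge labelled $\alpha\in\Sigma$ from $u\in V_l$ to $v\in V_{l+1}$ if $\alpha x\in u$ for some $x\in v$. Let $\Omega$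 be the projective limit of the discrete sets $V_l$ along the maps $V_{l+1}\to V_l$ given by inclusion of classes. For $u=(u^l)_l,v=(v^l)_l\in\Omega$ write $u\xrightarrow{\alpha}v$ if for every $l$ there is an edge labelled $\alpha$ from $u^l$ to $v^{l+1}$. Let $$G_\beta^{(0)}=\Big\{(\alpha_i,u_i)_{i\ge1}\in\prod_{i\ge1}(\Sigma\times\Omega)\ \Big|\ u_i\xrightarrow{\alpha_{i+1}}u_{i+1}\ (i\ge1),\ u_0\xrightarrow{\alpha_1}u_1\text{ for some }u_0\in\Omega\Big\}$$ with the product topology, let $\sigma_\beta((\alpha_i,u_i)_{i\ge1})=(\alpha_{i+1},u_{i+1})_{i\ge1}$, and let $$G_\beta=\{(x,k-l,y)\in G_\beta^{(0)}\times\mathbb Z\times G_\beta^{(0)}\mid \sigma_\beta^k(x)=\sigma_\beta^l(y),\ k,l\in\mathbb Z_{\ge 0}\},$$ with $r(x,n,y)=x$, $s(x,n,y)=y$, $(x,n,y)(y,m,z)=(x,n+m,z)$, $(x,n,y)^{-1}=(y,-n,x)$, and with the topology generated by the sets $\{(x,k-l,y)\mid x\in U,\ y\in V,\ \sigma_\beta^k(x)=\sigma_\beta^l(y)\}$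 for $k,l\ge0$ and $U,V\subseteq G_\beta^{(0)}$ open. Then: 1. $G_\beta$ is an étale groupoid: a second countable, locally compact Hausdorff topological groupoid whose range and source maps are local homeomorphisms, the unit map $x\mapsto(x,0,x)$ being a homeomorphism of $G_\beta^{(0)}$ onto an open subset of $G_\beta$. 2. $G_\beta$ is essentially principal: the interior of $\{g\in G_\beta\mid r(g)=s(g)\}$ is the set of units. 3. $G_\beta$ is purely infinite: for every clopen set $A\subseteq G_\beta^{(0)}$ there exist clopen sets $U,V\subseteq G_\beta$, on each of which $r$ and $s$ are injective, such that $s(U)=s(V)=A$, $r(U)\cup r(V)\subseteq A$ and $r(U)\cap r(V)=\emptyset$. 4. $G_\beta$ is minimal: for every $x\in G_\beta^{(0)}$ the orbit $\{r(g)\mid s(g)=x\}$ is dense in $G_\beta^{(0)}$. -/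

import Mathlib

open Set Topology

noncomputable section

namespace BetaShift

/-! ## The beta-shift -/

/-- The `β`-transformation `f_β(x) = βx - [βx]`. -/
def betaMap (β x : ℝ) : ℝ := Int.fract (β * x)

/-- The digits of the `β`-expansion, numbered from `0`: `digit β x n` is `[β f_β^n(x)]`. -/
def digit (β x : ℝ) (n : ℕ) : ℕ := ⌊β * (betaMap β)^[n] x⌋₊

/-- The alphabet `Σ = {0, …, N - 1}`, where `N` is the natural number with `N - 1 < β ≤ N`. -/
abbrev Alphabet (β : ℝ) : Type := Fin ⌈β⌉₊

instance (β : ℝ) [h : Fact (1 < β)] : NeZero ⌈β⌉₊ :=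
  ⟨(Nat.ceil_pos.mpr (zero_lt_one.trans h.out)).ne'⟩

/-- The `β`-expansions of the points of `[0, 1)`, as points of `Σ^ℕ` with its lexicographic
order. -/
def expansions (β : ℝ) : Set (Lex (ℕ → Alphabet β)) :=
  {ω | ∃ x ∈ Ico (0 : ℝ) 1, ∀ n, (ofLex ω n : ℕ) = digit β x n}

/-- `ξ_β`, the lexicographic supremum of the `β`-expansions of the points of `[0, 1)`. -/
def xi (β : ℝ) [Fact (1 < β)] : Lex (ℕ → Alphabet β) := sSup (expansions β)

/-- The (one-sided) `β`-shift `X_β`: all `ω` with `σ^m(ω) ≤ ξ_β` for every `m`. -/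
def betaShift (β : ℝ) [Fact (1 < β)] : Set (ℕ → Alphabet β) :=
  {ω | ∀ m : ℕ, toLex (fun n => ω (n + m)) ≤ xi β}

/-! ## The canonical lambda-graph system of a one-sided subshift, and its shift space -/

section LambdaGraph

variable {A : Type} (X : Set (ℕ → A))

/-- The concatenation `μ x` of a word `μ` of length `l` and a sequence `x`. -/
def prepend {A : Type} {l : ℕ} (μ : Fin l → A) (x : ℕ → A) : ℕ → A :=
  fun n => if h : n < l then μ ⟨n, h⟩ else x (n - l)

/-- `l`-past equivalence on `X`: the same words `μ` of length `l` satisfy `μ x ∈ X`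
and `μ y ∈ X`. -/
def pastSetoid (l : ℕ) : Setoid X where
  r x y := ∀ μ : Fin l → A, prepend μ x.1 ∈ X ↔ prepend μ y.1 ∈ X
  iseqv := ⟨fun _ _ => Iff.rfl, fun h μ => (h μ).symm, fun h h' μ => (h μ).trans (h' μ)⟩

/-- The vertices of level `l`: the `l`-past equivalence classes. -/
def Vertex (l : ℕ) : Type := Quotient (pastSetoid X l)

/-- Vertex sets are discrete. -/
instance (l : ℕ) : TopologicalSpace (Vertex X l) := ⊥

instance (l : ℕ) : DiscreteTopology (Vertex X l) := ⟨rfl⟩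

/-- The `l`-past equivalence class of a point of `X`. -/
def pastClass (l : ℕ) (x : X) : Vertex X l := Quotient.mk (pastSetoid X l) x

/-- The `ι`-map from level `l + 1` to level `l`, as a relation: the class `v` of level `l + 1` is
contained in the class `u` of level `l`. -/
def IotaRel (l : ℕ) (u : Vertex X l) (v : Vertex X (l + 1)) : Prop :=
  ∃ x : X, pastClass X l x = u ∧ pastClass X (l + 1) x = v

/-- There is an edge labelled `a` from the vertex `u` of level `l` to the vertex `v` of level
`l + 1`: `a x` lies in the class `u` for some `x` in the class `v`. -/
def Edge (l : ℕ) (u : Vertex X l) (a : A) (v : Vertex X (l + 1)) : Prop :=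
  ∃ (x : X) (h : prepend (fun _ : Fin 1 => a) x.1 ∈ X),
    pastClass X l ⟨_, h⟩ = u ∧ pastClass X (l + 1) x = v

/-- The projective limit `Ω` of the vertex sets along the `ι`-maps. -/
def Omega : Type := {u : ∀ l : ℕ, Vertex X l // ∀ l, IotaRel X l (u l) (u (l + 1))}

instance : TopologicalSpace (Omega X) :=
  inferInstanceAs (TopologicalSpace {u : ∀ l : ℕ, Vertex X l // ∀ l, IotaRel X l (u l) (u (l + 1))})

/-- The continuous graph of the `λ`-graph system: the triples `(u, a, v)` in `Ω × A × Ω` such that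
at every level `l` there is an edge labelled `a` from `u l` to `v (l + 1)`. -/
def OmegaEdge (u : Omega X) (a : A) (v : Omega X) : Prop :=
  ∀ l, Edge X l (u.1 l) a (v.1 (l + 1))

/-- The space of the one-sided paths `u₀ -α₁→ u₁ -α₂→ u₂ -α₃→ ⋯` of the continuous graph, recorded
as the sequences `(α_i, u_i)`, `i ≥ 1`; the initial vertex `u₀` is only required to exist. The
entry with index `i` below is `(α_{i+1}, u_{i+1})`. -/
def PathSpace : Type :=
  {p : ℕ → A × Omega X // (∃ u₀, OmegaEdge X u₀ (p 0).1 (p 0).2) ∧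
    ∀ i, OmegaEdge X (p i).2 (p (i + 1)).1 (p (i + 1)).2}

/-- The path space carries the topology of the product `∏ (A × Ω)`. -/
instance [TopologicalSpace A] : TopologicalSpace (PathSpace X) :=
  inferInstanceAs (TopologicalSpace {p : ℕ → A × Omega X //
    (∃ u₀, OmegaEdge X u₀ (p 0).1 (p 0).2) ∧
      ∀ i, OmegaEdge X (p i).2 (p (i + 1)).1 (p (i + 1)).2})

/-- The shift of the path space: delete the first entry `(α₁, u₁)`. -/
def pathShift (p : PathSpace X) : PathSpace X :=
  ⟨fun i => p.1 (i + 1), ⟨(p.1 0).2, p.2.2 0⟩, fun i => p.2.2 (i + 1)⟩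

end LambdaGraph

/-! ## Groupoids -/

/-- A groupoid with set of arrows `Γ` and set of units `Y`. The product `g h` is defined when the
source of `g` is the range of `h`. -/
structure ArrowGroupoid (Γ Y : Type) where
  r : Γ → Y
  s : Γ → Y
  one : Y → Γ
  mul : ∀ g h : Γ, s g = r h → Γ
  inv : Γ → Γ
  r_one : ∀ x, r (one x) = x
  s_one : ∀ x, s (one x) = x
  r_mul : ∀ g h e, r (mul g h e) = r g
  s_mul : ∀ g h e, s (mul g h e) = s h
  r_inv : ∀ g, r (inv g) = s g
  s_inv : ∀ g, s (inv g) = r g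
  one_mul : ∀ g, mul (one (r g)) g (s_one _) = g
  mul_one : ∀ g, mul g (one (s g)) (r_one _).symm = g
  mul_assoc : ∀ g h k (e : s g = r h) (e' : s h = r k),
    mul (mul g h e) k ((s_mul g h e).trans e') = mul g (mul h k e') (e.trans (r_mul h k e').symm)
  mul_inv : ∀ g, mul g (inv g) (r_inv g).symm = one (r g)
  inv_mul : ∀ g, mul (inv g) g (s_inv g) = one (s g)

namespace ArrowGroupoid

variable {Γ Y : Type} (G : ArrowGroupoid Γ Y)

/-- An étale groupoid: a second countable locally compact Hausdorff topological groupoid whose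
range and source maps are local homeomorphisms, the units forming an open subspace. -/
structure IsEtale [TopologicalSpace Γ] [TopologicalSpace Y] : Prop where
  hausdorff : T2Space Γ
  locallyCompact : LocallyCompactSpace Γ
  secondCountable : SecondCountableTopology Γ
  continuous_mul : Continuous
    fun p : {p : Γ × Γ // G.s p.1 = G.r p.2} => G.mul p.1.1 p.1.2 p.2
  continuous_inv : Continuous G.inv
  isOpenEmbedding_one : IsOpenEmbedding G.one
  isLocalHomeomorph_r : IsLocalHomeomorph G.r
  isLocalHomeomorph_s : IsLocalHomeomorph G.s

/-- The interior of the isotropy bundle is the unit space. -/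
def IsEssentiallyPrincipal [TopologicalSpace Γ] : Prop :=
  interior {g | G.r g = G.s g} = range G.one

/-- Every orbit `r(Gx)` is dense in the unit space. -/
def IsMinimal [TopologicalSpace Y] : Prop :=
  ∀ x : Y, Dense (G.r '' {g | G.s g = x})

/-- A `G`-set: a set of arrows on which `r` and `s` are injective. -/
def IsGSet (U : Set Γ) : Prop := InjOn G.r U ∧ InjOn G.s U

/-- For every clopen set `A` of units there are clopen `G`-sets `U`, `V` with
`s(U) = s(V) = A`, `r(U) ∪ r(V) ⊆ A` and `r(U) ∩ r(V) = ∅`. -/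
def IsPurelyInfinite [TopologicalSpace Γ] [TopologicalSpace Y] : Prop :=
  ∀ A : Set Y, IsClopen A → ∃ U V : Set Γ,
    IsClopen U ∧ IsClopen V ∧ G.IsGSet U ∧ G.IsGSet V ∧
    G.s '' U = A ∧ G.s '' V = A ∧ G.r '' U ∪ G.r '' V ⊆ A ∧ Disjoint (G.r '' U) (G.r '' V)

end ArrowGroupoid

/-! ## The groupoid of a transformation -/

section DeaconuRenault

variable {Y : Type} (T : Y → Y)

/-- The arrows `(x, k - l, y)` with `T^k(x) = T^l(y)`, `k, l ≥ 0`. -/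
def DRArrow : Type :=
  {g : Y × ℤ × Y // ∃ k l : ℕ, g.2.1 = (k : ℤ) - l ∧ T^[k] g.1 = T^[l] g.2.2}

/-- The basic sets of arrows `{(x, k - l, y) | x ∈ U, y ∈ V, T^k(x) = T^l(y)}`. -/
def drBasic (k l : ℕ) (U V : Set Y) : Set (DRArrow T) :=
  {g | g.1.2.1 = (k : ℤ) - l ∧ g.1.1 ∈ U ∧ g.1.2.2 ∈ V ∧ T^[k] g.1.1 = T^[l] g.1.2.2}

/-- The topology generated by the basic sets for all `k`, `l` and all open `U`, `V`. -/
instance [TopologicalSpace Y] : TopologicalSpace (DRArrow T) :=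
  TopologicalSpace.generateFrom
    {W | ∃ (k l : ℕ) (U V : Set Y), IsOpen U ∧ IsOpen V ∧ W = drBasic T k l U V}

/-- The Deaconu–Renault groupoid of `T`: `r(x, n, y) = x`, `s(x, n, y) = y`,
`(x, n, y)(y, m, z) = (x, n + m, z)` and `(x, n, y)⁻¹ = (y, -n, x)`. -/
def drGroupoid : ArrowGroupoid (DRArrow T) Y where
  r g := g.1.1
  s g := g.1.2.2
  one x := ⟨(x, 0, x), 0, 0, by simp⟩
  mul g h e := ⟨(g.1.1, g.1.2.1 + h.1.2.1, h.1.2.2), by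
    obtain ⟨⟨x, n, y⟩, k, l, hn, hg⟩ := g
    obtain ⟨⟨y', m, z⟩, k', l', hm, hh⟩ := h
    simp only at e hn hg hm hh ⊢
    subst e
    refine ⟨k' + k, l + l', by push_cast; omega, ?_⟩
    rw [Function.iterate_add_apply, hg, Function.iterate_add_apply, ← hh,
      ← Function.iterate_add_apply, ← Function.iterate_add_apply, Nat.add_comm]⟩
  inv g := ⟨(g.1.2.2, -g.1.2.1, g.1.1), by
    obtain ⟨k, l, hn, hg⟩ := g.2
    exact ⟨l, k, by simp only; omega, hg.symm⟩⟩
  r_one _ := rfl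
  s_one _ := rfl
  r_mul _ _ _ := rfl
  s_mul _ _ _ := rfl
  r_inv _ := rfl
  s_inv _ := rfl
  one_mul g := Subtype.ext (Prod.ext rfl (Prod.ext (zero_add _) rfl))
  mul_one g := Subtype.ext (Prod.ext rfl (Prod.ext (add_zero _) rfl))
  mul_assoc g h k _ _ := Subtype.ext (Prod.ext rfl (Prod.ext (add_assoc _ _ _) rfl))
  mul_inv g := Subtype.ext (Prod.ext rfl (Prod.ext (add_neg_cancel _) rfl))
  inv_mul g := Subtype.ext (Prod.ext rfl (Prod.ext (neg_add_cancel _) rfl))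

end DeaconuRenault

/-- The unit space of `G_β`: the path space of the canonical `λ`-graph system of `X_β`. -/
abbrev UnitSpace (β : ℝ) [Fact (1 < β)] : Type := PathSpace (betaShift β)

/-- The continuous map `σ_β` on the unit space of `G_β`. -/
abbrev sigmaBeta (β : ℝ) [Fact (1 < β)] : UnitSpace β → UnitSpace β := pathShift (betaShift β)

/-- The groupoid `G_β = {(x, k - l, y) | σ_β^k(x) = σ_β^l(y), k, l ≥ 0}`. -/
def betaGroupoid (β : ℝ) [Fact (1 < β)] : ArrowGroupoid (DRArrow (sigmaBeta β)) (UnitSpace β) :=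
  drGroupoid (sigmaBeta β)

end BetaShift

end

noncomputable section

/-! About `X_β` only two facts are used: `ξ_β` itself lies in `X_β` (`xi_mem`) and is not eventually
zero (`xi_not_eventually_zero`). Hence 0 can be put in front of every point of `X_β`.

This padding makes the past classes of level `l + 1` refine those of level `l` and decide which
letters may be prepended. So an edge of the continuous graph has at most one source for given label
and target, and the existence of that source is a clopen condition. The path shift is then a local
homeomorphism of a compact second countable Hausdorff space, and the groupoid of such a map is étale
(`isEtale_drGroupoid`).

The other three properties rest on `HasFullBranches`: into every nonempty open set maps an inverse
branch of some iterate, defined on the whole space. Its value over `x` lies in the orbit of `x`,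
which gives minimality. An identity `T^k = T^l` on an open set would spread to the whole space,
where it fails. Branches into two disjoint open parts of a clopen set give pure infiniteness.

The branches come from `hasFullExtensions_shiftBelow`. A past class is determined by comparison with
finitely many tails of `ξ_β`. Follow a long prefix of a point by a long block of zeros: failing
comparisons already fail within the prefix, and the others persist because the zeros drop below
every relevant tail of `ξ_β`. Whatever comes afterwards is arbitrary. -/

namespace BetaShift

/-! ## The groupoid of a local homeomorphism -/

section DeaconuRenault

variable {Y : Type} {T : Y → Y}

/-- A map is locally injective if every point has an open neighbourhood on which it is injective. -/
def LocInj [TopologicalSpace Y] (T : Y → Y) : Prop :=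
  ∀ y, ∃ U : Set Y, IsOpen U ∧ y ∈ U ∧ InjOn T U

theorem LocInj.iterate [TopologicalSpace Y] (hI : LocInj T) (hT : Continuous T) (n : ℕ) :
    LocInj T^[n] := by
  induction n with
  | zero => exact fun y => ⟨univ, isOpen_univ, mem_univ _, fun a _ b _ h => h⟩
  | succ n ih =>
    intro y
    obtain ⟨U, hU, hyU, hUi⟩ := hI y
    obtain ⟨V, hV, hyV, hVi⟩ := ih (T y)
    refine ⟨U ∩ T ⁻¹' V, hU.inter (hV.preimage hT), ⟨hyU, hyV⟩, fun a ha b hb h => ?_⟩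
    exact hUi ha.1 hb.1 (hVi ha.2 hb.2 h)

theorem isOpenMap_iterate [TopologicalSpace Y] (hO : IsOpenMap T) (n : ℕ) : IsOpenMap T^[n] := by
  induction n with
  | zero => exact IsOpenMap.id
  | succ n ih => exact ih.comp hO

theorem DRArrow.ext' {g h : DRArrow T} (h1 : g.1.1 = h.1.1) (h2 : g.1.2.1 = h.1.2.1)
    (h3 : g.1.2.2 = h.1.2.2) : g = h :=
  Subtype.ext (Prod.ext h1 (Prod.ext h2 h3))

theorem drBasic_subset_add (k l j : ℕ) (U V : Set Y) :
    drBasic T k l U V ⊆ drBasic T (k + j) (l + j) U V := by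
  rintro g ⟨hn, hU, hV, h⟩
  refine ⟨by push_cast; omega, hU, hV, ?_⟩
  rw [Nat.add_comm k, Nat.add_comm l, Function.iterate_add_apply, h, Function.iterate_add_apply]

/-- The common arrow `g` forces equal degrees, so both exponents differ by the same `j`, and the
equation with the smaller exponents implies the other. -/
theorem drBasic_inter_of_le {k l k' l' : ℕ} {U V U' V' : Set Y} (hk : k ≤ k') {g : DRArrow T}
    (hg : g ∈ drBasic T k l U V) (hg' : g ∈ drBasic T k' l' U' V') :
    drBasic T k l (U ∩ U') (V ∩ V') ⊆ drBasic T k l U V ∩ drBasic T k' l' U' V' := by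
  obtain ⟨j, rfl⟩ := Nat.exists_eq_add_of_le hk
  obtain rfl : l' = l + j := by have := hg.1; have := hg'.1; push_cast at this; omega
  exact fun h hh => ⟨⟨hh.1, hh.2.1.1, hh.2.2.1.1, hh.2.2.2⟩,
    drBasic_subset_add k l j U' V' ⟨hh.1, hh.2.1.2, hh.2.2.1.2, hh.2.2.2⟩⟩

variable [TopologicalSpace Y]

theorem isOpen_drBasic (k l : ℕ) {U V : Set Y} (hU : IsOpen U) (hV : IsOpen V) :
    IsOpen (drBasic T k l U V) :=
  TopologicalSpace.isOpen_generateFrom_of_mem ⟨k, l, U, V, hU, hV, rfl⟩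

theorem isTopologicalBasis_drBasic : TopologicalSpace.IsTopologicalBasis
    {W : Set (DRArrow T) | ∃ (k l : ℕ) (U V : Set Y), IsOpen U ∧ IsOpen V ∧
      W = drBasic T k l U V} where
  exists_subset_inter := by
    rintro _ ⟨k, l, U, V, hU, hV, rfl⟩ _ ⟨k', l', U', V', hU', hV', rfl⟩ g ⟨hg, hg'⟩
    rcases le_total k k' with h | h
    · exact ⟨_, ⟨k, l, _, _, hU.inter hU', hV.inter hV', rfl⟩,
        ⟨hg.1, ⟨hg.2.1, hg'.2.1⟩, ⟨hg.2.2.1, hg'.2.2.1⟩, hg.2.2.2⟩, drBasic_inter_of_le h hg hg'⟩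
    · refine ⟨_, ⟨k', l', _, _, hU'.inter hU, hV'.inter hV, rfl⟩,
        ⟨hg'.1, ⟨hg'.2.1, hg.2.1⟩, ⟨hg'.2.2.1, hg.2.2.1⟩, hg'.2.2.2⟩, ?_⟩
      rw [inter_comm (drBasic T k l U V)]
      exact drBasic_inter_of_le h hg' hg
  sUnion_eq := by
    refine eq_univ_of_forall fun g => ?_
    obtain ⟨k, l, hn, h⟩ := g.2
    exact ⟨_, ⟨k, l, univ, univ, isOpen_univ, isOpen_univ, rfl⟩, hn, trivial, trivial, h⟩
  eq_generateFrom := rfl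

theorem continuous_dr_r : Continuous (drGroupoid T).r := by
  rw [continuous_def]
  intro U hU
  rw [isTopologicalBasis_drBasic.isOpen_iff]
  intro g hg
  obtain ⟨k, l, hn, h⟩ := g.2
  exact ⟨_, ⟨k, l, U, univ, hU, isOpen_univ, rfl⟩, ⟨hn, hg, trivial, h⟩, fun x hx => hx.2.1⟩

theorem continuous_dr_s : Continuous (drGroupoid T).s := by
  rw [continuous_def]
  intro U hU
  rw [isTopologicalBasis_drBasic.isOpen_iff]
  intro g hg
  obtain ⟨k, l, hn, h⟩ := g.2
  exact ⟨_, ⟨k, l, univ, U, isOpen_univ, hU, rfl⟩, ⟨hn, trivial, hg, h⟩, fun x hx => hx.2.2.1⟩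

theorem continuous_dr_degree : Continuous fun g : DRArrow T => g.1.2.1 := by
  rw [continuous_def]
  intro U _
  rw [isTopologicalBasis_drBasic.isOpen_iff]
  intro g hg
  obtain ⟨k, l, hn, h⟩ := g.2
  refine ⟨_, ⟨k, l, univ, univ, isOpen_univ, isOpen_univ, rfl⟩, ⟨hn, trivial, trivial, h⟩,
    fun x hx => ?_⟩
  change x.1.2.1 ∈ U
  rw [hx.1, ← hn]
  exact hg

theorem continuous_dr_inv : Continuous (drGroupoid T).inv := by
  rw [isTopologicalBasis_drBasic.continuous_iff]
  rintro _ ⟨k, l, U, V, hU, hV, rfl⟩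
  convert isOpen_drBasic (T := T) l k hV hU using 1
  ext g
  constructor
  · rintro ⟨h1, h2, h3, h4⟩
    exact ⟨by change -g.1.2.1 = _ at h1; omega, h3, h2, h4.symm⟩
  · rintro ⟨h1, h2, h3, h4⟩
    exact ⟨by change -g.1.2.1 = _; omega, h3, h2, h4.symm⟩

/-- Near `g`, local injectivity cancels `j` applications of `T`. Continuity of the product needs
this, since multiplying basic sets raises the exponents. -/
theorem drBasic_shrink (hI : LocInj T) (hT : Continuous T) {k l : ℕ} (j : ℕ) {U V : Set Y}
    (hU : IsOpen U) (hV : IsOpen V) {g : DRArrow T} (hg : g ∈ drBasic T k l U V) :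
    ∃ U' V' : Set Y, IsOpen U' ∧ IsOpen V' ∧ g.1.1 ∈ U' ∧ g.1.2.2 ∈ V' ∧
      drBasic T (k + j) (l + j) U' V' ⊆ drBasic T k l U V := by
  obtain ⟨W, hW, hgW, hWi⟩ := hI.iterate hT j (T^[k] g.1.1)
  refine ⟨U ∩ T^[k] ⁻¹' W, V ∩ T^[l] ⁻¹' W, hU.inter (hW.preimage (hT.iterate k)),
    hV.inter (hW.preimage (hT.iterate l)), ⟨hg.2.1, hgW⟩, ⟨hg.2.2.1, ?_⟩, ?_⟩
  · rw [mem_preimage, ← hg.2.2.2]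
    exact hgW
  · rintro h ⟨h1, h2, h3, h4⟩
    refine ⟨by push_cast at h1; omega, h2.1, h3.1, hWi h2.2 h3.2 ?_⟩
    rwa [Nat.add_comm k, Nat.add_comm l, Function.iterate_add_apply,
      Function.iterate_add_apply] at h4

theorem continuous_dr_mul (hI : LocInj T) (hT : Continuous T) :
    Continuous fun p : {p : DRArrow T × DRArrow T // (drGroupoid T).s p.1 = (drGroupoid T).r p.2} =>
      (drGroupoid T).mul p.1.1 p.1.2 p.2 := by
  rw [isTopologicalBasis_drBasic.continuous_iff]
  rintro _ ⟨p, q, U, V, hU, hV, rfl⟩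
  rw [isOpen_iff_mem_nhds]
  rintro ⟨⟨g, h⟩, e⟩ hgh
  obtain ⟨k, l, hkl, hg⟩ := g.2
  obtain ⟨m, n, hmn, hh⟩ := h.2
  have hg' := drBasic_subset_add k l p univ univ (show g ∈ drBasic T k l univ univ from
    ⟨hkl, trivial, trivial, hg⟩)
  have hdeg : g.1.2.1 + h.1.2.1 = (p : ℤ) - q := hgh.1
  obtain ⟨U', V', hU', hV', hgU, hhV, hsub⟩ := drBasic_shrink hI hT (k + m) hU hV hgh
  -- Adding the degrees of `g` and `h` gives `p - q`. With exponents `(k + p, l + p)` for the first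
  -- factor and `(m, n)` for the second, products satisfy the equation with exponents `p + (k + m)`
  -- and `q + (k + m)`.
  have hq : q + (k + m) = n + (l + p) := by omega
  have hO : IsOpen (drBasic T (k + p) (l + p) U' univ ×ˢ drBasic T m n univ V') :=
    (isOpen_drBasic _ _ hU' isOpen_univ).prod (isOpen_drBasic _ _ isOpen_univ hV')
  refine Filter.mem_of_superset ((hO.preimage continuous_subtype_val).mem_nhds
    ⟨⟨hg'.1, hgU, trivial, hg'.2.2.2⟩, hmn, trivial, hhV, hh⟩) ?_
  rintro ⟨⟨a, b⟩, e'⟩ ⟨⟨ha1, ha2, -, ha4⟩, hb1, -, hb3, hb4⟩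
  refine hsub ⟨?_, ha2, hb3, ?_⟩
  · change a.1.2.1 + b.1.2.1 = _
    push_cast at *
    omega
  · change T^[p + (k + m)] a.1.1 = T^[q + (k + m)] b.1.2.2
    change a.1.2.2 = b.1.1 at e'
    rw [hq, show p + (k + m) = m + (k + p) by omega, Function.iterate_add_apply, ha4,
      Nat.add_comm n, Function.iterate_add_apply T (l + p), ← hb4, ← e',
      ← Function.iterate_add_apply, ← Function.iterate_add_apply, Nat.add_comm]

theorem isOpenMap_dr_r (hT : Continuous T) (hO : IsOpenMap T) : IsOpenMap (drGroupoid T).r := by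
  rw [isTopologicalBasis_drBasic.isOpenMap_iff]
  rintro _ ⟨k, l, U, V, hU, hV, rfl⟩
  convert hU.inter ((isOpenMap_iterate hO l V hV).preimage (hT.iterate k)) using 1
  ext x
  constructor
  · rintro ⟨g, hg, rfl⟩
    exact ⟨hg.2.1, g.1.2.2, hg.2.2.1, hg.2.2.2.symm⟩
  · rintro ⟨hx, y, hy, hxy⟩
    exact ⟨⟨(x, (k : ℤ) - l, y), k, l, rfl, hxy.symm⟩, ⟨rfl, hx, hy, hxy.symm⟩, rfl⟩

theorem isLocalHomeomorph_dr_r (hI : LocInj T) (hT : Continuous T) (hO : IsOpenMap T) :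
    IsLocalHomeomorph (drGroupoid T).r := by
  rw [isLocalHomeomorph_iff_isOpenEmbedding_restrict]
  intro g
  obtain ⟨k, l, hn, hg⟩ := g.2
  -- Where `T^l` is injective, the range `x` determines the source `y` through `T^l y = T^k x`.
  obtain ⟨V, hV, hgV, hVi⟩ := hI.iterate hT l g.1.2.2
  have hB := isOpen_drBasic (T := T) k l isOpen_univ hV
  refine ⟨drBasic T k l univ V, hB.mem_nhds ⟨hn, trivial, hgV, hg⟩, ?_⟩
  refine .of_continuous_injective_isOpenMap (continuous_dr_r.comp continuous_subtype_val) ?_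
    ((isOpenMap_dr_r hT hO).comp hB.isOpenMap_subtype_val)
  rintro ⟨a, ha⟩ ⟨b, hb⟩ (hab : a.1.1 = b.1.1)
  refine Subtype.ext (DRArrow.ext' hab (ha.1.trans hb.1.symm) (hVi ha.2.2.1 hb.2.2.1 ?_))
  rw [← ha.2.2.2, ← hb.2.2.2, hab]

/-- Inversion is a homeomorphism of the arrow space. -/
def drInvHomeomorph : DRArrow T ≃ₜ DRArrow T where
  toFun := (drGroupoid T).inv
  invFun := (drGroupoid T).inv
  left_inv _ := DRArrow.ext' rfl (neg_neg _) rfl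
  right_inv _ := DRArrow.ext' rfl (neg_neg _) rfl
  continuous_toFun := continuous_dr_inv
  continuous_invFun := continuous_dr_inv

theorem isLocalHomeomorph_dr_s (hI : LocInj T) (hT : Continuous T) (hO : IsOpenMap T) :
    IsLocalHomeomorph (drGroupoid T).s :=
  (isLocalHomeomorph_dr_r hI hT hO).comp drInvHomeomorph.isLocalHomeomorph

theorem isOpenEmbedding_dr_one : IsOpenEmbedding (drGroupoid T).one := by
  refine .of_continuous_injective_isOpenMap ?_ (fun x y h => congrArg (drGroupoid T).r h) ?_
  · rw [isTopologicalBasis_drBasic.continuous_iff]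
    rintro _ ⟨k, l, U, V, hU, hV, rfl⟩
    by_cases hkl : k = l
    · subst hkl
      convert hU.inter hV using 1
      ext x
      exact ⟨fun h => ⟨h.2.1, h.2.2.1⟩, fun h => ⟨(sub_self _).symm, h.1, h.2, rfl⟩⟩
    · convert isOpen_empty using 1
      refine eq_empty_of_forall_notMem fun x hx => hkl ?_
      have : (0 : ℤ) = k - l := hx.1
      omega
  · intro U hU
    convert isOpen_drBasic (T := T) 0 0 hU hU using 1
    ext g
    constructor
    · rintro ⟨x, hx, rfl⟩
      exact ⟨rfl, hx, hx, rfl⟩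
    · rintro ⟨h1, h2, -, h4⟩
      exact ⟨g.1.1, h2, DRArrow.ext' rfl h1.symm h4⟩

theorem t2Space_dr [T2Space Y] : T2Space (DRArrow T) :=
  .of_injective_continuous
    (f := fun g : DRArrow T => (((drGroupoid T).r g, (drGroupoid T).s g), g.1.2.1))
    (fun _ _ h => DRArrow.ext' (congrArg (·.1.1) h) (congrArg (·.2) h) (congrArg (·.1.2) h))
    ((continuous_dr_r.prodMk continuous_dr_s).prodMk continuous_dr_degree)

theorem locallyCompactSpace_of_isLocalHomeomorph {Z : Type*} [TopologicalSpace Z]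
    [LocallyCompactSpace Y] {f : Z → Y} (hf : IsLocalHomeomorph f) : LocallyCompactSpace Z :=
  letI : ChartedSpace Y Z :=
    { atlas := univ
      chartAt := fun g => (hf g).choose
      mem_chart_source := fun g => (hf g).choose_spec.1
      chart_mem_atlas := fun _ => trivial }
  ChartedSpace.locallyCompactSpace Y Z

theorem secondCountableTopology_dr [SecondCountableTopology Y] :
    SecondCountableTopology (DRArrow T) := by
  set B := TopologicalSpace.countableBasis Y
  have hB := TopologicalSpace.isBasis_countableBasis Y
  have hbasis : TopologicalSpace.IsTopologicalBasis
      ((fun p : (ℕ × ℕ) × Set Y × Set Y => drBasic T p.1.1 p.1.2 p.2.1 p.2.2) ''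
        (univ ×ˢ (B ×ˢ B))) := by
    refine isTopologicalBasis_drBasic.isTopologicalBasis_of_exists_subset ?_ ?_
    · rintro _ ⟨p, hp, rfl⟩
      exact isOpen_drBasic _ _ (hB.isOpen hp.2.1) (hB.isOpen hp.2.2)
    · rintro _ ⟨k, l, U, V, hU, hV, rfl⟩ g hg
      obtain ⟨U', hU', hgU, hUU⟩ := hB.exists_subset_of_mem_open hg.2.1 hU
      obtain ⟨V', hV', hgV, hVV⟩ := hB.exists_subset_of_mem_open hg.2.2.1 hV
      exact ⟨_, ⟨((k, l), U', V'), ⟨trivial, hU', hV'⟩, rfl⟩, ⟨hg.1, hgU, hgV, hg.2.2.2⟩,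
        fun h hh => ⟨hh.1, hUU hh.2.1, hVV hh.2.2.1, hh.2.2.2⟩⟩
  refine hbasis.secondCountableTopology (Countable.image ?_ _)
  exact countable_univ.prod ((TopologicalSpace.countable_countableBasis Y).prod
    (TopologicalSpace.countable_countableBasis Y))

theorem isEtale_drGroupoid [T2Space Y] [LocallyCompactSpace Y] [SecondCountableTopology Y]
    (hI : LocInj T) (hT : Continuous T) (hO : IsOpenMap T) : (drGroupoid T).IsEtale where
  hausdorff := t2Space_dr
  locallyCompact := locallyCompactSpace_of_isLocalHomeomorph (isLocalHomeomorph_dr_r hI hT hO)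
  secondCountable := secondCountableTopology_dr
  continuous_mul := continuous_dr_mul hI hT
  continuous_inv := continuous_dr_inv
  isOpenEmbedding_one := isOpenEmbedding_dr_one
  isLocalHomeomorph_r := isLocalHomeomorph_dr_r hI hT hO
  isLocalHomeomorph_s := isLocalHomeomorph_dr_s hI hT hO

/-! ### Consequences of full inverse branches -/

/-- Every nonempty open set contains the image of a branch, defined on the whole space and with
clopen domain of injectivity, of the inverse of an iterate of `T`. -/
def HasFullBranches (T : Y → Y) : Prop :=
  ∀ U : Set Y, IsOpen U → U.Nonempty → ∃ (n : ℕ) (C : Set Y), IsClopen C ∧ InjOn T^[n] C ∧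
    ∀ y, ∃ z ∈ U ∩ C, T^[n] z = y

theorem HasFullBranches.isMinimal (h : HasFullBranches T) : (drGroupoid T).IsMinimal := by
  intro x
  rw [dense_iff_inter_open]
  intro U hU hne
  obtain ⟨n, C, -, -, hs⟩ := h U hU hne
  obtain ⟨z, hz, hzx⟩ := hs x
  exact ⟨z, hz.1, ⟨(z, n, x), n, 0, by simp, hzx⟩, rfl, rfl⟩

/-- An open set of isotropy arrows has an open range on which `T^k = T^l`. For `k ≠ l`, applying
`T^n` along a full branch extends this to all of `Y`, against `hper`; for `k = l` the arrows are
units. -/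
theorem HasFullBranches.isEssentiallyPrincipal (h : HasFullBranches T) (hT : Continuous T)
    (hO : IsOpenMap T) (hper : ∀ k l : ℕ, k < l → ∃ y, T^[k] y ≠ T^[l] y) :
    (drGroupoid T).IsEssentiallyPrincipal := by
  have key : ∀ (U : Set Y), IsOpen U → U.Nonempty → ∀ k l : ℕ, k < l →
      (∀ z ∈ U, T^[k] z = T^[l] z) → False := by
    intro U hU hne k l hkl hz
    obtain ⟨n, C, -, -, hs⟩ := h U hU hne
    obtain ⟨y, hy⟩ := hper k l hkl
    obtain ⟨z, hzU, rfl⟩ := hs y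
    apply hy
    rw [← Function.iterate_add_apply, ← Function.iterate_add_apply, Nat.add_comm k, Nat.add_comm l,
      Function.iterate_add_apply, hz z hzU.1, Function.iterate_add_apply]
  refine subset_antisymm (fun g hg => ?_) ?_
  · obtain ⟨W, hWs, hW, hgW⟩ := mem_interior.1 hg
    obtain ⟨_, ⟨k, l, U, V, hU, hV, rfl⟩, hgB, hBW⟩ :=
      isTopologicalBasis_drBasic.exists_subset_of_mem_open hgW hW
    have hR := isOpenMap_dr_r hT hO _ (isOpen_drBasic (T := T) k l hU hV)
    have hz : ∀ z ∈ (drGroupoid T).r '' drBasic T k l U V, T^[k] z = T^[l] z := by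
      rintro _ ⟨a, ha, rfl⟩
      have hrs : a.1.1 = a.1.2.2 := hWs (hBW ha)
      exact ha.2.2.2.trans (congrArg _ hrs.symm)
    rcases lt_trichotomy k l with hkl | rfl | hkl
    · exact (key _ hR ⟨_, g, hgB, rfl⟩ k l hkl hz).elim
    · exact ⟨g.1.1, DRArrow.ext' rfl ((sub_self _).symm.trans hgB.1.symm) (hWs hgW)⟩
    · exact (key _ hR ⟨_, g, hgB, rfl⟩ l k hkl fun z hzz => (hz z hzz).symm).elim
  · refine interior_maximal ?_ isOpenEmbedding_dr_one.isOpen_range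
    rintro _ ⟨x, rfl⟩
    rfl

/-- A full branch of the inverse of `T^n` with values in `W` yields a clopen `G`-set with any
prescribed clopen source and with range in `W`. -/
theorem exists_isGSet_of_branch [T2Space Y] (hT : Continuous T) {A W C : Set Y} (hA : IsClopen A)
    {n : ℕ} (hC : IsClopen C) (hinj : InjOn T^[n] C) (hs : ∀ y, ∃ z ∈ W ∩ C, T^[n] z = y) :
    ∃ S : Set (DRArrow T), IsClopen S ∧ (drGroupoid T).IsGSet S ∧ (drGroupoid T).s '' S = A ∧
      (drGroupoid T).r '' S ⊆ W := by
  -- Since the second exponent is 0, the source is a function of the range, and the set is cut out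
  -- by closed conditions.
  refine ⟨drBasic T n 0 C A, ⟨?_, isOpen_drBasic n 0 hC.isOpen hA.isOpen⟩, ⟨?_, ?_⟩, ?_, ?_⟩
  · have := t2Space_dr (T := T)
    exact ((isClosed_singleton (x := (n : ℤ) - (0 : ℕ))).preimage continuous_dr_degree).inter
      ((hC.isClosed.preimage continuous_dr_r).inter ((hA.isClosed.preimage continuous_dr_s).inter
        (isClosed_eq ((hT.iterate n).comp continuous_dr_r) continuous_dr_s)))
  · rintro a ⟨ha1, -, -, ha4⟩ b ⟨hb1, -, -, hb4⟩ (hab : a.1.1 = b.1.1)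
    refine DRArrow.ext' hab (ha1.trans hb1.symm) ?_
    rw [hab] at ha4
    exact ha4.symm.trans hb4
  · rintro a ⟨ha1, ha2, -, ha4⟩ b ⟨hb1, hb2, -, hb4⟩ (hab : a.1.2.2 = b.1.2.2)
    refine DRArrow.ext' (hinj ha2 hb2 ?_) (ha1.trans hb1.symm) hab
    rw [ha4, hb4, hab]
  · refine subset_antisymm ?_ fun y hy => ?_
    · rintro _ ⟨a, ha, rfl⟩
      exact ha.2.2.1
    · obtain ⟨z, hz, hzy⟩ := hs y
      exact ⟨⟨(z, (n : ℤ) - (0 : ℕ), y), n, 0, rfl, hzy⟩, ⟨rfl, hz.2, hy, hzy⟩, rfl⟩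
  · rintro _ ⟨a, ⟨-, ha2, -, -⟩, rfl⟩
    -- The range of `a` is only known to lie in `C`. The branch point over its image lies in `W ∩
    -- C`, and injectivity on `C` identifies the two.
    obtain ⟨z, hz, hzy⟩ := hs (T^[n] a.1.1)
    change a.1.1 ∈ W
    rw [← hinj hz.2 ha2 hzy]
    exact hz.1

/-- A branch is defined on the whole space, so its source can be cut down to `A` even when its
values lie in a small part of `A`. -/
theorem HasFullBranches.isPurelyInfinite [T2Space Y] (h : HasFullBranches T) (hT : Continuous T)
    (hsplit : ∀ U : Set Y, IsOpen U → U.Nonempty → ∃ U₁ U₂ : Set Y, IsOpen U₁ ∧ IsOpen U₂ ∧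
      U₁.Nonempty ∧ U₂.Nonempty ∧ U₁ ⊆ U ∧ U₂ ⊆ U ∧ Disjoint U₁ U₂) :
    (drGroupoid T).IsPurelyInfinite := by
  intro A hA
  rcases A.eq_empty_or_nonempty with rfl | hne
  · exact ⟨∅, ∅, isClopen_empty, isClopen_empty, ⟨injOn_empty _, injOn_empty _⟩,
      ⟨injOn_empty _, injOn_empty _⟩, by simp⟩
  · obtain ⟨U₁, U₂, hU₁, hU₂, hne₁, hne₂, hs₁, hs₂, hd⟩ := hsplit A hA.isOpen hne
    obtain ⟨n₁, C₁, hC₁, hi₁, hb₁⟩ := h U₁ hU₁ hne₁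
    obtain ⟨n₂, C₂, hC₂, hi₂, hb₂⟩ := h U₂ hU₂ hne₂
    obtain ⟨S₁, hS₁, hG₁, hsrc₁, hr₁⟩ := exists_isGSet_of_branch hT hA hC₁ hi₁ hb₁
    obtain ⟨S₂, hS₂, hG₂, hsrc₂, hr₂⟩ := exists_isGSet_of_branch hT hA hC₂ hi₂ hb₂
    exact ⟨S₁, S₂, hS₁, hS₂, hG₁, hG₂, hsrc₁, hsrc₂,
      union_subset (hr₁.trans hs₁) (hr₂.trans hs₂), hd.mono hr₁ hr₂⟩

end DeaconuRenault

/-! ## The path space of the canonical lambda-graph system -/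

section LambdaGraph

variable {A : Type}

theorem prepend_of_lt {l : ℕ} (μ : Fin l → A) (x : ℕ → A) {t : ℕ} (h : t < l) :
    prepend μ x t = μ ⟨t, h⟩ := dif_pos h

theorem prepend_add {l : ℕ} (μ : Fin l → A) (x : ℕ → A) (t : ℕ) : prepend μ x (t + l) = x t := by
  simp [prepend]

/-- The sequence `a x` for a letter `a`. -/
abbrev cons (a : A) (x : ℕ → A) : ℕ → A := prepend (fun _ : Fin 1 => a) x

theorem cons_succ (a : A) (x : ℕ → A) (t : ℕ) : cons a x (t + 1) = x t := prepend_add _ _ _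

theorem cons_eq_of {a : A} {x y : ℕ → A} (h0 : y 0 = a) (h1 : ∀ t, y (t + 1) = x t) :
    cons a x = y := by
  ext t
  cases t with
  | zero => exact h0.symm
  | succ t => rw [cons_succ, h1]

/-- The first `m` letters of `c`, followed by `x`. -/
abbrev pre (m : ℕ) (c x : ℕ → A) : ℕ → A := prepend (fun i : Fin m => c i) x

theorem pre_of_lt {m t : ℕ} (c x : ℕ → A) (h : t < m) : pre m c x t = c t := prepend_of_lt _ _ h

theorem pre_of_le {m t : ℕ} (c x : ℕ → A) (h : m ≤ t) : pre m c x t = x (t - m) := by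
  simp [prepend, not_lt.2 h]

theorem pre_succ_succ (m : ℕ) (c x : ℕ → A) (t : ℕ) :
    pre (m + 1) c x (t + 1) = pre m (fun i => c (i + 1)) x t := by
  by_cases h : t < m
  · rw [pre_of_lt _ _ h, pre_of_lt _ _ (by omega)]
  · rw [pre_of_le _ _ (not_lt.1 h), pre_of_le _ _ (by omega), Nat.add_sub_add_right]

theorem prepend_cons {l : ℕ} (μ : Fin l → A) (a : A) (x : ℕ → A) :
    prepend μ (cons a x) = prepend (Fin.snoc μ a : Fin (l + 1) → A) x := by
  ext t
  rcases lt_trichotomy t l with h | rfl | h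
  · rw [prepend_of_lt _ _ h, prepend_of_lt _ _ (by omega)]
    exact (Fin.snoc_castSucc (α := fun _ => A) a μ ⟨t, h⟩).symm
  · rw [prepend_of_lt _ _ (Nat.lt_succ_self t)]
    have := prepend_add μ (cons a x) 0
    rw [Nat.zero_add] at this
    rw [this]
    exact (Fin.snoc_last (α := fun _ => A) a μ).symm
  · obtain ⟨j, rfl⟩ := Nat.exists_eq_add_of_lt h
    rw [show l + j + 1 = j + 1 + l by omega, prepend_add, cons_succ,
      show j + 1 + l = j + (l + 1) by omega, prepend_add]

theorem cons_prepend {l : ℕ} (μ : Fin l → A) (a : A) (x : ℕ → A) :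
    cons a (prepend μ x) = prepend (Fin.cons a μ : Fin (l + 1) → A) x := by
  refine cons_eq_of (prepend_of_lt _ _ (Nat.succ_pos l)) fun t => ?_
  by_cases h : t < l
  · rw [prepend_of_lt _ _ h, prepend_of_lt _ _ (by omega)]
    exact Fin.cons_succ (α := fun _ => A) a μ ⟨t, h⟩
  · obtain ⟨j, rfl⟩ := Nat.exists_eq_add_of_le (not_lt.1 h)
    rw [Nat.add_comm l j, prepend_add, Nat.add_assoc, prepend_add]

variable {X : Set (ℕ → A)}

/-- A shift-invariant set of sequences with a letter that can be put in front of all of them. -/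
structure IsPadded (X : Set (ℕ → A)) : Prop where
  shift : ∀ x ∈ X, (fun t => x (t + 1)) ∈ X
  pad : ∃ a, ∀ x ∈ X, cons a x ∈ X

namespace IsPadded

theorem drop (hX : IsPadded X) {x : ℕ → A} (hx : x ∈ X) (n : ℕ) : (fun t => x (t + n)) ∈ X := by
  induction n with
  | zero => exact hx
  | succ n ih => simpa only [Nat.add_assoc, Nat.add_comm 1 n] using hX.shift _ ih

theorem of_prepend (hX : IsPadded X) {l : ℕ} {μ : Fin l → A} {x : ℕ → A} (h : prepend μ x ∈ X) :
    x ∈ X := by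
  simpa only [prepend_add] using hX.drop h l

theorem exists_prepend (hX : IsPadded X) (l : ℕ) : ∃ μ : Fin l → A, ∀ x ∈ X, prepend μ x ∈ X := by
  obtain ⟨a, ha⟩ := hX.pad
  induction l with
  | zero => exact ⟨Fin.elim0, fun x hx => hx⟩
  | succ l ih =>
    obtain ⟨μ, hμ⟩ := ih
    exact ⟨Fin.cons a μ, fun x hx => cons_prepend μ a x ▸ ha _ (hμ x hx)⟩

end IsPadded

theorem pastClass_eq_iff {l : ℕ} {x y : X} :
    pastClass X l x = pastClass X l y ↔ ∀ μ : Fin l → A, prepend μ x.1 ∈ X ↔ prepend μ y.1 ∈ X :=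
  Quotient.eq

theorem exists_pastClass {l : ℕ} (u : Vertex X l) : ∃ x, pastClass X l x = u :=
  Quotient.exists_rep u

/-- A word `μ` in front of `a x` is the longer word `μ a` in front of `x`; this costs one level. -/
theorem pastClass_cons {l : ℕ} {x y : X}
    (h : pastClass X (l + 1) x = pastClass X (l + 1) y) {a : A} (hx : cons a x.1 ∈ X)
    (hy : cons a y.1 ∈ X) : pastClass X l ⟨_, hx⟩ = pastClass X l ⟨_, hy⟩ := by
  rw [pastClass_eq_iff] at h ⊢
  intro μ
  simp only [prepend_cons, h]

namespace IsPadded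

/-- Past equivalence tests words of one exact length; the padding letter turns a test of length `l`
into one of length `l + 1`. -/
theorem pastClass_of_succ (hX : IsPadded X) {l : ℕ} {x y : X}
    (h : pastClass X (l + 1) x = pastClass X (l + 1) y) : pastClass X l x = pastClass X l y := by
  obtain ⟨a, ha⟩ := hX.pad
  rw [pastClass_eq_iff] at h ⊢
  have key : ∀ (x : ℕ → A) (μ : Fin l → A), prepend μ x ∈ X ↔
      prepend (Fin.cons a μ : Fin (l + 1) → A) x ∈ X := fun x μ => by
    rw [← cons_prepend]
    exact ⟨ha _, hX.of_prepend⟩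
  intro μ
  rw [key, h, ← key]

theorem cons_mem_of_pastClass (hX : IsPadded X) {l : ℕ} {x y : X}
    (h : pastClass X (l + 1) x = pastClass X (l + 1) y) {a : A} (hx : cons a x.1 ∈ X) :
    cons a y.1 ∈ X := by
  obtain ⟨μ, hμ⟩ := hX.exists_prepend l
  have := hμ _ hx
  rw [prepend_cons, pastClass_eq_iff.1 h, ← prepend_cons] at this
  exact hX.of_prepend this

/-- `IotaRel` only provides one common point of the two classes; refinement extends it to every
representative. -/
theorem pastClass_omega_of_le (hX : IsPadded X) (u : Omega X) {l L : ℕ} (hl : l ≤ L) {x : X}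
    (hx : pastClass X L x = u.1 L) : pastClass X l x = u.1 l := by
  induction L, hl using Nat.le_induction with
  | base => exact hx
  | succ L _ ih =>
    obtain ⟨y, hy, hy'⟩ := u.2 L
    exact ih ((hX.pastClass_of_succ (hx.trans hy'.symm)).trans hy)

/-- Replaces the existential choice of a representative in `Edge` by an arbitrary one. -/
theorem omegaEdge_iff (hX : IsPadded X) {u : Omega X} {a : A} {v : Omega X} :
    OmegaEdge X u a v ↔ ∀ l (x : X), pastClass X (l + 1) x = v.1 (l + 1) →
      ∃ h : cons a x.1 ∈ X, pastClass X l ⟨_, h⟩ = u.1 l := by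
  constructor
  · intro h l x hx
    obtain ⟨y, hy, hyu, hyv⟩ := h l
    have hyx := hyv.trans hx.symm
    have hx' := hX.cons_mem_of_pastClass hyx hy
    exact ⟨hx', (pastClass_cons hyx hy hx').symm.trans hyu⟩
  · intro h l
    obtain ⟨x, hx⟩ := exists_pastClass (v.1 (l + 1))
    obtain ⟨h1, h2⟩ := h l x hx
    exact ⟨x, h1, h2, hx⟩

theorem exists_omegaEdge_iff (hX : IsPadded X) {a : A} {v : Omega X} :
    (∃ u, OmegaEdge X u a v) ↔ ∀ x : X, pastClass X 1 x = v.1 1 → cons a x.1 ∈ X := by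
  constructor
  · rintro ⟨u, hu⟩ x hx
    exact (hX.omegaEdge_iff.1 hu 0 x hx).1
  · intro h
    -- The source at level `l` is the class of `a x` for a representative `x` of level `l + 1`.
    choose x hx using fun l => exists_pastClass (v.1 (l + 1))
    have hmem : ∀ l, cons a (x l).1 ∈ X := fun l =>
      h _ (hX.pastClass_omega_of_le v (Nat.le_add_left 1 l) (hx l))
    refine ⟨⟨fun l => pastClass X l ⟨_, hmem l⟩, fun l => ⟨⟨_, hmem (l + 1)⟩, ?_, rfl⟩⟩,
      fun l => ⟨x l, hmem l, rfl, hx l⟩⟩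
    exact pastClass_cons ((hX.pastClass_omega_of_le v (Nat.le_succ _) (hx (l + 1))).trans
      (hx l).symm) _ _

theorem omegaEdge_unique (hX : IsPadded X) {u u' : Omega X} {a : A} {v : Omega X}
    (h : OmegaEdge X u a v) (h' : OmegaEdge X u' a v) : u = u' := by
  refine Subtype.ext (funext fun l => ?_)
  obtain ⟨x, hx⟩ := exists_pastClass (v.1 (l + 1))
  obtain ⟨_, h1⟩ := hX.omegaEdge_iff.1 h l x hx
  obtain ⟨_, h2⟩ := hX.omegaEdge_iff.1 h' l x hx
  exact h1.symm.trans h2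

end IsPadded

/-- The initial vertex `u₀` of a path. -/
def initial (p : PathSpace X) : Omega X := p.2.1.choose

theorem omegaEdge_initial (p : PathSpace X) : OmegaEdge X (initial p) (p.1 0).1 (p.1 0).2 :=
  p.2.1.choose_spec

theorem pathShift_iterate_val (p : PathSpace X) (n i : ℕ) :
    ((pathShift X)^[n] p).1 i = p.1 (i + n) := by
  induction n generalizing p with
  | zero => rfl
  | succ n ih =>
    rw [Function.iterate_succ_apply, ih]
    rfl

/-- The path `a p`, where `a` is the label of an edge that ends at the initial vertex of `p`. -/
def consPath (a : A) (p : PathSpace X) (h : ∃ u, OmegaEdge X u a (initial p)) : PathSpace X :=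
  ⟨fun i => Nat.casesOn i (a, initial p) p.1, h, fun i => Nat.casesOn i (omegaEdge_initial p) p.2.2⟩

namespace IsPadded

/-- Sources are unique, so each vertex is recovered from the rest of the path. The shift therefore
loses only the first label. -/
theorem eq_initial (hX : IsPadded X) (p : PathSpace X) (i : ℕ) :
    (p.1 i).2 = initial ((pathShift X)^[i + 1] p) := by
  refine hX.omegaEdge_unique (p.2.2 i) ?_
  convert omegaEdge_initial ((pathShift X)^[i + 1] p) using 1 <;>
  · rw [pathShift_iterate_val, Nat.zero_add]

theorem pathShift_injOn (hX : IsPadded X) (a : A) :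
    InjOn (pathShift X) {p | (p.1 0).1 = a} := by
  intro p hp q hq h
  refine Subtype.ext (funext fun i => ?_)
  cases i with
  | zero =>
    refine Prod.ext ((show (p.1 0).1 = a from hp).trans hq.symm) ?_
    rw [hX.eq_initial, hX.eq_initial, Function.iterate_one, h]
  | succ i => exact congrFun (congrArg Subtype.val h) i

theorem pathShift_iterate_injOn (hX : IsPadded X) (n : ℕ) (c : ℕ → A) :
    InjOn (pathShift X)^[n] {p | ∀ i < n, (p.1 i).1 = c i} := by
  induction n generalizing c with
  | zero => exact fun p _ q _ h => h
  | succ n ih =>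
    intro p hp q hq h
    refine hX.pathShift_injOn (c 0) (hp 0 n.succ_pos) (hq 0 n.succ_pos) ?_
    exact ih (fun i => c (i + 1)) (fun i hi => hp (i + 1) (by omega))
      (fun i hi => hq (i + 1) (by omega)) h

/-- Every path looks, up to any given level and length, like a point of `X`. -/
theorem exists_approx (hX : IsPadded X) (p : PathSpace X) (n L : ℕ) :
    ∃ x : X, (∀ t < n, x.1 t = (p.1 t).1) ∧ ∀ i ≤ n, ∀ y : X, (∀ t, y.1 t = x.1 (t + i)) →
      pastClass X L y = (initial ((pathShift X)^[i] p)).1 L := by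
  induction n generalizing p L with
  | zero =>
    obtain ⟨x, hx⟩ := exists_pastClass ((initial p).1 L)
    refine ⟨x, fun t ht => absurd ht (Nat.not_lt_zero t), fun i hi y hy => ?_⟩
    obtain rfl := Nat.le_zero.1 hi
    obtain rfl : y = x := Subtype.ext (funext hy)
    exact hx
  | succ n ih =>
    -- One extra level is requested because prepending the first label consumes it.
    obtain ⟨x, hx, hx'⟩ := ih (pathShift X p) (L + 1)
    have hinit : pastClass X (L + 1) x = ((p.1 0).2).1 (L + 1) := by
      rw [hX.eq_initial]
      exact hx' 0 (Nat.zero_le n) x fun t => rfl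
    obtain ⟨h1, h2⟩ := hX.omegaEdge_iff.1 (omegaEdge_initial p) L x hinit
    refine ⟨⟨_, h1⟩, fun t ht => ?_, fun i hi y hy => ?_⟩
    · cases t with
      | zero => rfl
      | succ t => exact (cons_succ (p.1 0).1 _ t).trans (hx t (by omega))
    · cases i with
      | zero =>
        obtain rfl : y = ⟨_, h1⟩ := Subtype.ext (funext hy)
        exact h2
      | succ i =>
        refine hX.pastClass_omega_of_le _ (Nat.le_succ L) (hx' i (by omega) y fun t => ?_)
        rw [hy, ← Nat.add_assoc]
        exact cons_succ (p.1 0).1 _ _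

/-- A word that can be put in front of every point of `X` can be put in front of every path. -/
theorem exists_pre_path (hX : IsPadded X) (m : ℕ) (c : ℕ → A) (hc : ∀ x ∈ X, pre m c x ∈ X)
    (q : PathSpace X) : ∃ p : PathSpace X, (pathShift X)^[m] p = q ∧ (∀ i < m, (p.1 i).1 = c i) ∧
      ∀ i ≤ m, ∀ l L, l + m ≤ L → ∀ x y : X, pastClass X L x = (initial q).1 L →
        (∀ t, y.1 t = pre m c x.1 (t + i)) →
        pastClass X l y = (initial ((pathShift X)^[i] p)).1 l := by
  induction m generalizing c with
  | zero =>
    refine ⟨q, rfl, fun i hi => absurd hi (Nat.not_lt_zero i), fun i hi l L hL x y hx hy => ?_⟩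
    obtain rfl := Nat.le_zero.1 hi
    obtain rfl : y = x := Subtype.ext (funext hy)
    exact hX.pastClass_omega_of_le _ hL hx
  | succ m ih =>
    have hcons : ∀ x, cons (c 0) (pre m (fun i => c (i + 1)) x) = pre (m + 1) c x := fun x =>
      cons_eq_of (pre_of_lt _ _ m.succ_pos) (pre_succ_succ m c x)
    have hc' : ∀ x ∈ X, pre m (fun i => c (i + 1)) x ∈ X := fun x hx => by
      simpa only [pre_succ_succ] using hX.shift _ (hc x hx)
    obtain ⟨p, hp, hpc, hpi⟩ := ih (fun i => c (i + 1)) hc'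
    -- Admissibility of a letter depends on a level 1 class only, here represented by the remaining
    -- word in front of a point `y` of the class of `q`. The whole word fits in front of `y`.
    have hadm : ∃ u, OmegaEdge X u (c 0) (initial p) := by
      rw [hX.exists_omegaEdge_iff]
      intro x hx
      obtain ⟨y, hy⟩ := exists_pastClass ((initial q).1 (1 + m))
      have h1 := hpi 0 m.zero_le 1 (1 + m) le_rfl y ⟨_, hc' y.1 y.2⟩ hy fun t => rfl
      refine hX.cons_mem_of_pastClass (l := 0) (h1.trans hx.symm) ?_
      rw [hcons]
      exact hc y.1 y.2
    refine ⟨consPath (c 0) p hadm, hp, fun i hi => ?_, fun i hi l L hL x y hx hy => ?_⟩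
    · cases i with
      | zero => rfl
      | succ i => exact hpc i (by omega)
    · cases i with
      | zero =>
        have h1 := hpi 0 m.zero_le (l + 1) L (by omega) x ⟨_, hc' x.1 x.2⟩ hx fun t => rfl
        obtain ⟨h2, h3⟩ := hX.omegaEdge_iff.1 (omegaEdge_initial (consPath (c 0) p hadm)) l _ h1
        obtain rfl : y = ⟨_, h2⟩ := Subtype.ext ((funext hy).trans (hcons x.1).symm)
        exact h3
      | succ i =>
        refine hpi i (by omega) l L (by omega) x y hx fun t => ?_
        rw [hy, ← Nat.add_assoc, pre_succ_succ]

/-- The path of the tails of a point of `X`. -/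
theorem exists_path (hX : IsPadded X) (x : X) : ∃ p : PathSpace X, ∀ i, (p.1 i).1 = x.1 i := by
  let u : ℕ → Omega X := fun i =>
    ⟨fun l => pastClass X l ⟨_, hX.drop x.2 i⟩, fun l => ⟨_, rfl, rfl⟩⟩
  have hu : ∀ i, OmegaEdge X (u i) (x.1 i) (u (i + 1)) := fun i l => by
    have hc : cons (x.1 i) (fun t => x.1 (t + (i + 1))) = fun t => x.1 (t + i) :=
      cons_eq_of (by rw [Nat.zero_add]) fun t => by rw [Nat.add_assoc, Nat.add_comm 1]
    refine ⟨⟨_, hX.drop x.2 (i + 1)⟩, ?_, ?_, rfl⟩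
    · change cons (x.1 i) (fun t => x.1 (t + (i + 1))) ∈ X
      rw [hc]
      exact hX.drop x.2 i
    · exact congrArg (pastClass X l) (Subtype.ext hc)
  exact ⟨⟨fun i => (x.1 i, u (i + 1)), ⟨_, hu 0⟩, fun i => hu (i + 1)⟩, fun i => rfl⟩

end IsPadded

end LambdaGraph

/-! ### Topology of the path space and properties of its groupoid -/

section LambdaGraphTopology

variable {A : Type} {X : Set (ℕ → A)}

theorem continuous_omega_apply (l : ℕ) : Continuous fun u : Omega X => u.1 l :=
  (continuous_apply l).comp continuous_subtype_val

instance : T2Space (Omega X) :=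
  inferInstanceAs (T2Space {u : ∀ l : ℕ, Vertex X l // ∀ l, IotaRel X l (u l) (u (l + 1))})

theorem isClosed_omega :
    IsClosed {u : ∀ l : ℕ, Vertex X l | ∀ l, IotaRel X l (u l) (u (l + 1))} := by
  rw [ofPred_forall]
  refine isClosed_iInter fun l => ?_
  exact (isClosed_discrete {v : Vertex X l × Vertex X (l + 1) | IotaRel X l v.1 v.2}).preimage
    ((continuous_apply l).prodMk (continuous_apply (l + 1)))

theorem compactSpace_omega (hfin : ∀ l, Finite (Vertex X l)) : CompactSpace (Omega X) :=
  isCompact_iff_compactSpace.1 isClosed_omega.isCompact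

theorem secondCountableTopology_omega (hfin : ∀ l, Finite (Vertex X l)) :
    SecondCountableTopology (Omega X) :=
  have (l : ℕ) : SecondCountableTopology (Vertex X l) := have := hfin l; inferInstance
  TopologicalSpace.Subtype.secondCountableTopology _

variable [TopologicalSpace A]

theorem continuous_path_apply (i : ℕ) : Continuous fun p : PathSpace X => p.1 i :=
  (continuous_apply i).comp continuous_subtype_val

theorem continuous_path_label (i : ℕ) : Continuous fun p : PathSpace X => (p.1 i).1 :=
  continuous_fst.comp (continuous_path_apply i)

theorem continuous_path_vertex (i l : ℕ) : Continuous fun p : PathSpace X => (p.1 i).2.1 l :=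
  (continuous_omega_apply l).comp (continuous_snd.comp (continuous_path_apply i))

theorem secondCountableTopology_path [Finite A] (hfin : ∀ l, Finite (Vertex X l)) :
    SecondCountableTopology (PathSpace X) :=
  have := secondCountableTopology_omega hfin
  TopologicalSpace.Subtype.secondCountableTopology _

theorem continuous_pathShift : Continuous (pathShift X) :=
  continuous_induced_rng.2 (continuous_pi fun i => continuous_path_apply (i + 1))

/-- A neighbourhood of a path contains all paths with the same labels and, up to some level, the
same vertices along an initial segment. -/
theorem exists_agree_subset {U : Set (PathSpace X)} (hU : IsOpen U) {p : PathSpace X}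
    (hp : p ∈ U) : ∃ n, ∀ q : PathSpace X,
      (∀ i < n, (q.1 i).1 = (p.1 i).1 ∧ ∀ l ≤ n, (q.1 i).2.1 l = (p.1 i).2.1 l) → q ∈ U := by
  -- Otherwise paths outside `U` that agree with `p` up to `n` would converge to `p`.
  by_contra! h
  choose q hq hqU using h
  have hlim : Filter.Tendsto q Filter.atTop (𝓝 p) := by
    refine tendsto_subtype_rng.2 (tendsto_pi_nhds.2 fun i => ?_)
    rw [nhds_prod_eq]
    refine Filter.Tendsto.prodMk (tendsto_nhds_of_eventually_eq ?_) ?_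
    · filter_upwards [Filter.eventually_gt_atTop i] with n hn using (hq n i hn).1
    · refine tendsto_subtype_rng.2 (tendsto_pi_nhds.2 fun l => ?_)
      refine tendsto_nhds_of_eventually_eq ?_
      filter_upwards [Filter.eventually_gt_atTop i, Filter.eventually_ge_atTop l] with n hn hl
        using (hq n i hn).2 l hl
  obtain ⟨n, hn⟩ := (hlim.eventually (hU.mem_nhds hp)).exists
  exact hqU n hn

variable [DiscreteTopology A]

instance : T2Space (PathSpace X) :=
  inferInstanceAs (T2Space {p : ℕ → A × Omega X // (∃ u₀, OmegaEdge X u₀ (p 0).1 (p 0).2) ∧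
      ∀ i, OmegaEdge X (p i).2 (p (i + 1)).1 (p (i + 1)).2})

theorem isClosed_omegaEdge {Z : Type*} [TopologicalSpace Z] {u v : Z → Omega X} {a : Z → A}
    (hu : Continuous u) (ha : Continuous a) (hv : Continuous v) :
    IsClosed {z | OmegaEdge X (u z) (a z) (v z)} := by
  have : {z | OmegaEdge X (u z) (a z) (v z)} =
      ⋂ l, {z | Edge X l ((u z).1 l) (a z) ((v z).1 (l + 1))} := by
    ext z
    simp [OmegaEdge]
  rw [this]
  refine isClosed_iInter fun l => ?_
  exact (isClosed_discrete {w : Vertex X l × A × Vertex X (l + 1) |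
    Edge X l w.1 w.2.1 w.2.2}).preimage (((continuous_omega_apply l).comp hu).prodMk
      (ha.prodMk ((continuous_omega_apply (l + 1)).comp hv)))

namespace IsPadded

/-- The condition factors through the discrete pair of the label and the level 1 vertex. It makes
the path space closed in the product despite the unrecorded `u₀`. -/
theorem isClopen_exists_omegaEdge (hX : IsPadded X) :
    IsClopen {w : A × Omega X | ∃ u, OmegaEdge X u w.1 w.2} := by
  have : {w : A × Omega X | ∃ u, OmegaEdge X u w.1 w.2} =
      (fun w : A × Omega X => (w.1, w.2.1 1)) ⁻¹'
        {w | ∀ x : X, pastClass X 1 x = w.2 → cons w.1 x.1 ∈ X} := by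
    ext w
    exact hX.exists_omegaEdge_iff
  rw [this]
  exact (isClopen_discrete _).preimage
    (continuous_fst.prodMk ((continuous_omega_apply 1).comp continuous_snd))

theorem compactSpace_path [Finite A] (hX : IsPadded X) (hfin : ∀ l, Finite (Vertex X l)) :
    CompactSpace (PathSpace X) := by
  have := compactSpace_omega hfin
  suffices h : IsClosed {p : ℕ → A × Omega X | (∃ u₀, OmegaEdge X u₀ (p 0).1 (p 0).2) ∧
      ∀ i, OmegaEdge X (p i).2 (p (i + 1)).1 (p (i + 1)).2} from
    isCompact_iff_compactSpace.1 h.isCompact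
  have h0 : Continuous fun p : ℕ → A × Omega X => p 0 := continuous_apply 0
  have h1 : IsClosed {p : ℕ → A × Omega X |
      ∀ i, OmegaEdge X (p i).2 (p (i + 1)).1 (p (i + 1)).2} := by
    rw [ofPred_forall]
    exact isClosed_iInter fun i => isClosed_omegaEdge (continuous_snd.comp (continuous_apply i))
      (continuous_fst.comp (continuous_apply (i + 1)))
      (continuous_snd.comp (continuous_apply (i + 1)))
  exact (hX.isClopen_exists_omegaEdge.isClosed.preimage h0).inter h1

/-- Level `l` of the initial vertex depends only on the first label and on level `l + 1` of the
first vertex. -/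
theorem continuous_initial (hX : IsPadded X) : Continuous (initial (X := X)) := by
  refine continuous_induced_rng.2 (continuous_pi fun l => ?_)
  rw [continuous_iff_continuousAt]
  intro p
  refine ContinuousAt.congr (f := fun _ => (initial p).1 l) continuousAt_const ?_
  have h1 := (continuous_path_label (X := X) 0).continuousAt (x := p)
    (IsOpen.mem_nhds (isOpen_discrete {(p.1 0).1}) rfl)
  have h2 := (continuous_path_vertex (X := X) 0 (l + 1)).continuousAt (x := p)
    (IsOpen.mem_nhds (isOpen_discrete {(p.1 0).2.1 (l + 1)}) rfl)
  filter_upwards [h1, h2] with q (hq1 : (q.1 0).1 = (p.1 0).1)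
    (hq2 : (q.1 0).2.1 (l + 1) = (p.1 0).2.1 (l + 1))
  obtain ⟨x, hx⟩ := exists_pastClass ((p.1 0).2.1 (l + 1))
  obtain ⟨_, h3⟩ := hX.omegaEdge_iff.1 (omegaEdge_initial p) l x hx
  obtain ⟨_, h4⟩ := hX.omegaEdge_iff.1 (omegaEdge_initial q) l x (hx.trans hq2.symm)
  simp only [Function.comp, hq1] at h4 ⊢
  exact h3.symm.trans h4

theorem locInj_pathShift (hX : IsPadded X) : LocInj (pathShift X) := fun p =>
  ⟨_, (isOpen_discrete {(p.1 0).1}).preimage (continuous_path_label 0), rfl, hX.pathShift_injOn _⟩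

/-- Prepending the first label of `p` is a continuous section of the shift, defined on the open set
`N` and taking the shift of `p` back to `p`. -/
theorem isOpenMap_pathShift (hX : IsPadded X) : IsOpenMap (pathShift X) := by
  intro U hU
  rw [isOpen_iff_mem_nhds]
  rintro _ ⟨p, hp, rfl⟩
  set a := (p.1 0).1 with ha
  let N : Set (PathSpace X) := {q | ∃ u, OmegaEdge X u a (initial q)}
  have hN : IsOpen N := hX.isClopen_exists_omegaEdge.isOpen.preimage
    (continuous_const.prodMk hX.continuous_initial)
  have hcont : Continuous fun q : N => consPath a q.1 q.2 := by
    refine continuous_induced_rng.2 (continuous_pi fun i => ?_)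
    cases i with
    | zero => exact continuous_const.prodMk (hX.continuous_initial.comp continuous_subtype_val)
    | succ i => exact (continuous_path_apply i).comp continuous_subtype_val
  have hpi : (p.1 0).2 = initial (pathShift X p) := hX.eq_initial p 0
  have hpN : pathShift X p ∈ N := ⟨initial p, hpi ▸ omegaEdge_initial p⟩
  have hpc : consPath a (pathShift X p) hpN = p := by
    refine hX.pathShift_injOn a ?_ ?_ ?_ <;> rfl
  refine Filter.mem_of_superset ((hN.isOpenMap_subtype_val _ (hU.preimage hcont)).mem_nhds
    ⟨⟨_, hpN⟩, ?_, rfl⟩) ?_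
  · rw [mem_preimage, hpc]
    exact hp
  · rintro _ ⟨q, hq, rfl⟩
    exact ⟨_, hq, rfl⟩

end IsPadded

/-- Every initial word of a point of `X` extends to a word that can be put in front of all points
of `X` and forces the past classes of the point, up to a given level and length. -/
def HasFullExtensions (X : Set (ℕ → A)) : Prop :=
  ∀ (x : X) (n L : ℕ), ∃ (m : ℕ) (c : ℕ → A), n ≤ m ∧ (∀ t < n, c t = x.1 t) ∧
    (∀ q ∈ X, pre m c q ∈ X) ∧ ∀ q ∈ X, ∀ i ≤ n, ∀ y z : X,
      (∀ t, y.1 t = pre m c q (t + i)) → (∀ t, z.1 t = x.1 (t + i)) →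
      pastClass X L y = pastClass X L z

namespace IsPadded

theorem hasFullBranches (hX : IsPadded X) (hE : HasFullExtensions X) :
    HasFullBranches (pathShift X) := by
  rintro U hU ⟨p, hp⟩
  obtain ⟨n, hn⟩ := exists_agree_subset hU hp
  obtain ⟨x, hx, hx'⟩ := hX.exists_approx p n n
  obtain ⟨m, c, hnm, hcx, hc, hc'⟩ := hE x n n
  refine ⟨m, {p | ∀ i < m, (p.1 i).1 = c i}, ?_, hX.pathShift_iterate_injOn m c, fun q => ?_⟩
  · have : {p : PathSpace X | ∀ i < m, (p.1 i).1 = c i} =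
        ⋂ i ∈ Finset.range m, (fun p : PathSpace X => (p.1 i).1) ⁻¹' {c i} := by
      ext p
      simp
    rw [this]
    exact isClopen_biInter_finset fun i _ =>
      (isClopen_discrete _).preimage (continuous_path_label i)
  · obtain ⟨z, hzq, hzc, hz⟩ := hX.exists_pre_path m c hc q
    refine ⟨z, ⟨hn z fun i hi => ⟨?_, fun l hl => ?_⟩, hzc⟩, hzq⟩
    · rw [hzc i (by omega), hcx i hi, hx i hi]
    · obtain ⟨y, hy⟩ := exists_pastClass ((initial q).1 (n + m))
      -- The vertices of `z`, the tails of the prefixed point, the tails of `x` and the vertices of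
      -- `p` have equal classes, in this order. The index is `i + 1` because entry `i` stores the
      -- end of its edge.
      have h1 := hz (i + 1) (by omega) n (n + m) le_rfl y
        ⟨_, hX.drop (hc _ y.2) (i + 1)⟩ hy fun t => rfl
      have h2 := hx' (i + 1) hi ⟨_, hX.drop x.2 (i + 1)⟩ fun t => rfl
      have h3 := hc' y.1 y.2 (i + 1) hi ⟨_, hX.drop (hc _ y.2) (i + 1)⟩
        ⟨_, hX.drop x.2 (i + 1)⟩ (fun t => rfl) fun t => rfl
      rw [hX.eq_initial, hX.eq_initial, ← hX.pastClass_omega_of_le _ hl h1,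
        ← hX.pastClass_omega_of_le _ hl (h3.trans h2)]

theorem drGroupoid_pathShift [Finite A] (hX : IsPadded X) (hfin : ∀ l, Finite (Vertex X l))
    (hE : HasFullExtensions X) (hper : ∀ k l : ℕ, k < l → ∃ x ∈ X, x k ≠ x l) :
    (drGroupoid (pathShift X)).IsEtale ∧ (drGroupoid (pathShift X)).IsEssentiallyPrincipal ∧
      (drGroupoid (pathShift X)).IsPurelyInfinite ∧ (drGroupoid (pathShift X)).IsMinimal := by
  have := hX.compactSpace_path hfin
  have := secondCountableTopology_path hfin
  have hB := hX.hasFullBranches hE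
  have hT := continuous_pathShift (X := X)
  have hO := hX.isOpenMap_pathShift
  refine ⟨isEtale_drGroupoid hX.locInj_pathShift hT hO,
    hB.isEssentiallyPrincipal hT hO fun k l hkl => ?_,
    hB.isPurelyInfinite hT fun U hU hne => ?_, hB.isMinimal⟩
  · obtain ⟨x, hx, hne⟩ := hper k l hkl
    obtain ⟨p, hp⟩ := hX.exists_path ⟨x, hx⟩
    refine ⟨p, fun h => hne ?_⟩
    have h0 := congrArg (fun p : PathSpace X => (p.1 0).1) h
    simpa only [pathShift_iterate_val, Nat.zero_add, hp] using h0
  · obtain ⟨x, hx, hxne⟩ := hper 0 1 one_pos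
    obtain ⟨p, hp⟩ : ∃ p : PathSpace X, ∀ i, (p.1 i).1 = x i := hX.exists_path ⟨x, hx⟩
    obtain ⟨n, C, -, -, hs⟩ := hB U hU hne
    have hc : Continuous fun q : PathSpace X => (q.1 n).1 := continuous_path_label n
    obtain ⟨z, hz, hzp⟩ := hs p
    obtain ⟨w, hw, hwp⟩ := hs (pathShift X p)
    have hzn : (z.1 n).1 = x 0 := by
      rw [← hp 0, ← hzp, pathShift_iterate_val, Nat.zero_add]
    have hwn : (w.1 n).1 = x 1 := by
      rw [← hp 1, ← Nat.zero_add n, ← pathShift_iterate_val, hwp]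
      rfl
    refine ⟨U ∩ (fun q : PathSpace X => (q.1 n).1) ⁻¹' {x 0},
      U ∩ (fun q : PathSpace X => (q.1 n).1) ⁻¹' {x 1},
      hU.inter ((isOpen_discrete _).preimage hc), hU.inter ((isOpen_discrete _).preimage hc),
      ⟨z, hz.1, hzn⟩, ⟨w, hw.1, hwn⟩, inter_subset_left, inter_subset_left, ?_⟩
    exact disjoint_left.2 fun q h1 h2 => hxne (h1.2.symm.trans h2.2)

end IsPadded

end LambdaGraphTopology

/-! ## Shift spaces bounded by a shift-maximal sequence -/

section ShiftBelow

variable {A : Type} [LinearOrder A]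

/-- The lexicographic order of sequences. -/
def LexLE (x y : ℕ → A) : Prop := ∀ i, (∀ j < i, x j = y j) → x i ≤ y i

theorem toLex_le_toLex_iff {x y : ℕ → A} : toLex x ≤ toLex y ↔ LexLE x y := by
  refine ⟨fun h i => Pi.apply_le_of_toLex h, fun h => ?_⟩
  by_contra hlt
  obtain ⟨i, hi, hi'⟩ := not_le.1 hlt
  exact (h i fun j hj => (hi j hj).symm).not_gt hi'

theorem LexLE.drop {x y : ℕ → A} {n : ℕ} (h : LexLE x y) (hn : ∀ j < n, x j = y j) :
    LexLE (fun t => x (t + n)) (fun t => y (t + n)) := by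
  intro i hi
  refine h _ fun j hj => ?_
  by_cases hjn : j < n
  · exact hn j hjn
  · have := hi (j - n) (by omega)
    simpa only [Nat.sub_add_cancel (not_lt.1 hjn)] using this

/-- A difference from `y` within the first `n` letters is decided by `x`; only without one do the
tails matter. -/
theorem LexLE.of_agree {w x y : ℕ → A} {n : ℕ} (h : LexLE x y) (hw : ∀ j < n, w j = x j)
    (hn : (∀ j < n, w j = y j) → LexLE (fun t => w (t + n)) (fun t => y (t + n))) :
    LexLE w y := by
  intro i hi
  by_cases hin : i < n
  · rw [hw i hin]
    exact h i fun j hj => (hw j (hj.trans hin)).symm.trans (hi j hj)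
  · have := hn (fun j hj => hi j (by omega)) (i - n) fun j hj => hi _ (by omega)
    simpa only [Nat.sub_add_cancel (not_lt.1 hin)] using this

theorem LexLE.of_bot [OrderBot A] {w y : ℕ → A} {n : ℕ} (hw : ∀ j < n, w j = ⊥)
    (hy : ∃ s < n, y s ≠ ⊥) : LexLE w y := by
  intro i hi
  obtain ⟨s, hs, hys⟩ := hy
  have his : i ≤ s := by
    by_contra h
    exact hys ((hi s (not_le.1 h)).symm.trans (hw s hs))
  rw [hw i (by omega)]
  exact bot_le

/-- The sequences all of whose tails are at most `ξ`. -/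
def shiftBelow (ξ : ℕ → A) : Set (ℕ → A) := {ω | ∀ m : ℕ, LexLE (fun n => ω (n + m)) ξ}

variable {ξ : ℕ → A}

theorem shiftBelow_of_prepend_drop {l m : ℕ} (hm : l ≤ m) (μ : Fin l → A) {x : ℕ → A}
    (hx : x ∈ shiftBelow ξ) : LexLE (fun t => prepend μ x (t + m)) ξ := by
  obtain ⟨j, rfl⟩ := Nat.exists_eq_add_of_le' hm
  simp only [← Nat.add_assoc, prepend_add]
  exact hx j

/-- The past class of a point is determined by the comparison with the tails of `ξ`. -/
theorem pastClass_shiftBelow {l : ℕ} {x y : shiftBelow ξ}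
    (h : ∀ k ≤ l, LexLE x.1 (fun t => ξ (t + k)) ↔ LexLE y.1 (fun t => ξ (t + k))) :
    pastClass (shiftBelow ξ) l x = pastClass (shiftBelow ξ) l y := by
  have key : ∀ x y : shiftBelow ξ,
      (∀ k ≤ l, LexLE x.1 (fun t => ξ (t + k)) → LexLE y.1 (fun t => ξ (t + k))) →
      ∀ μ : Fin l → A, prepend μ x.1 ∈ shiftBelow ξ → prepend μ y.1 ∈ shiftBelow ξ := by
    intro x y h μ hx m
    by_cases hm : l ≤ m
    · exact shiftBelow_of_prepend_drop hm μ y.2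
    -- A tail starting inside `μ` is either decided against `ξ` within `μ`, or it comes down to
    -- comparing `x` or `y` with `ξ` shifted by `l - m`.
    · have hagree : ∀ j < l - m, prepend μ y.1 (j + m) = prepend μ x.1 (j + m) := fun j hj => by
        rw [prepend_of_lt _ _ (by omega), prepend_of_lt _ _ (by omega)]
      refine (hx m).of_agree hagree fun hξ => ?_
      have h1 := (hx m).drop (n := l - m) fun j hj => (hagree j hj).symm.trans (hξ j hj)
      have hadd : ∀ t, t + (l - m) + m = t + l := fun t => by omega
      simp only [hadd, prepend_add] at h1 ⊢
      exact h _ (Nat.sub_le l m) h1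
  rw [pastClass_eq_iff]
  exact fun μ => ⟨key x y (fun k hk => (h k hk).1) μ, key y x (fun k hk => (h k hk).2) μ⟩

/-- A class is determined by a subset of `{0, …, l}`, the indices of the tails of `ξ` not exceeded.
-/
theorem finite_vertex_shiftBelow (l : ℕ) : Finite (Vertex (shiftBelow ξ) l) := by
  choose x hx using fun v : Vertex (shiftBelow ξ) l => exists_pastClass v
  refine Finite.of_injective
    (fun v => {k : Fin (l + 1) | LexLE (x v).1 (fun t => ξ (t + k))}) fun v w h => ?_
  rw [← hx v, ← hx w]
  exact pastClass_shiftBelow fun k hk => Set.ext_iff.1 h ⟨k, by omega⟩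

variable [OrderBot A]

/-- By shift-maximality, `ξ 0` bounds every letter of `ξ`. -/
theorem head_ne_bot (hξ : ξ ∈ shiftBelow ξ) (hbot : ∀ m, ∃ t, ξ (t + m) ≠ ⊥) : ξ 0 ≠ ⊥ := by
  intro h0
  obtain ⟨t, ht⟩ := hbot 0
  have := hξ t 0 fun j hj => absurd hj (Nat.not_lt_zero j)
  simp only [h0, Nat.zero_add, le_bot_iff] at this
  exact ht this

theorem pre_bot_mem_shiftBelow (h0 : ξ 0 ≠ ⊥) (n : ℕ) {x : ℕ → A} (hx : x ∈ shiftBelow ξ) :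
    pre n (fun _ => ⊥) x ∈ shiftBelow ξ := by
  intro m
  by_cases hm : n ≤ m
  · exact shiftBelow_of_prepend_drop hm _ hx
  · refine LexLE.of_bot (n := 1) (fun j hj => ?_) ⟨0, one_pos, h0⟩
    rw [pre_of_lt _ _ (by omega)]

theorem isPadded_shiftBelow (h0 : ξ 0 ≠ ⊥) : IsPadded (shiftBelow ξ) where
  shift x hx m := by simpa only [Nat.add_assoc, Nat.add_comm m 1] using hx (m + 1)
  pad := ⟨⊥, fun _ hx => pre_bot_mem_shiftBelow h0 1 hx⟩

theorem exists_ne_of_lt (hξ : ξ ∈ shiftBelow ξ) (h0 : ξ 0 ≠ ⊥) {k l : ℕ} (hkl : k < l) :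
    ∃ x ∈ shiftBelow ξ, x k ≠ x l := by
  refine ⟨_, pre_bot_mem_shiftBelow h0 l hξ, ?_⟩
  rw [pre_of_lt _ _ hkl, pre_of_le _ _ le_rfl, Nat.sub_self]
  exact h0.symm

theorem hasFullExtensions_shiftBelow (h0 : ξ 0 ≠ ⊥) (hbot : ∀ m, ∃ t, ξ (t + m) ≠ ⊥) :
    HasFullExtensions (shiftBelow ξ) := by
  intro x n L
  -- The prefix length `m` is chosen so that every failing comparison among the finitely many
  -- relevant ones is visible before position `m`.
  obtain ⟨m, hm, hnm⟩ : ∃ m, (∀ i ∈ Finset.range (n + 1), ∀ k ∈ Finset.range (L + 1),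
      ¬ LexLE (fun t => x.1 (t + i)) (fun t => ξ (t + k)) →
        ∃ r, r + i < m ∧ (∀ j < r, x.1 (j + i) = ξ (j + k)) ∧ ξ (r + k) < x.1 (r + i)) ∧
      n ≤ m := by
    refine Filter.Eventually.exists (f := Filter.atTop) (Filter.Eventually.and ?_
      (Filter.eventually_ge_atTop n))
    simp only [Filter.eventually_all_finset]
    intro i _ k _
    by_cases h : LexLE (fun t => x.1 (t + i)) (fun t => ξ (t + k))
    · exact Filter.Eventually.of_forall fun m h' => absurd h h'
    · simp only [LexLE, not_forall, not_le] at h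
      obtain ⟨r, hr, hr'⟩ := h
      filter_upwards [Filter.eventually_gt_atTop (r + i)] with m hm _ using ⟨r, hm, hr, hr'⟩
  -- The block length `M` is chosen so that every tail of `ξ` that can be met after the prefix
  -- leaves `⊥` within `M` letters; its index is `m - j + k ≤ L + m`.
  obtain ⟨M, hM⟩ : ∃ M, ∀ k ∈ Finset.range (L + m + 1), ∃ s < M, ξ (s + k) ≠ ⊥ := by
    refine Filter.Eventually.exists (f := Filter.atTop) ?_
    simp only [Filter.eventually_all_finset]
    intro k _
    obtain ⟨s, hs⟩ := hbot k
    filter_upwards [Filter.eventually_gt_atTop s] with M hM using ⟨s, hM, hs⟩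
  set c : ℕ → A := fun t => if t < m then x.1 t else ⊥ with hc
  have hpre : ∀ (q : ℕ → A), ∀ t < m, pre (m + M) c q t = x.1 t := fun q t ht => by
    rw [pre_of_lt _ _ (by omega), hc]
    exact if_pos ht
  have hpre' : ∀ (q : ℕ → A) t, m ≤ t → t < m + M → pre (m + M) c q t = ⊥ := fun q t ht ht' => by
    rw [pre_of_lt _ _ ht', hc]
    exact if_neg (not_lt.2 ht)
  have key : ∀ (q : ℕ → A), ∀ j ≤ m, ∀ k ≤ L, LexLE (fun t => x.1 (t + j)) (fun t => ξ (t + k)) →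
      LexLE (fun t => pre (m + M) c q (t + j)) (fun t => ξ (t + k)) := by
    intro q j hj k hk h
    refine h.of_agree (n := m - j) (fun t ht => hpre q _ (by omega)) fun _ => ?_
    refine LexLE.of_bot (n := M) (fun t ht => hpre' q _ (by omega) (by omega)) ?_
    obtain ⟨s, hs, hs'⟩ := hM (m - j + k) (Finset.mem_range.2 (by omega))
    exact ⟨s, hs, by rwa [Nat.add_assoc]⟩
  refine ⟨m + M, c, by omega, fun t ht => if_pos (by omega), fun q hq i => ?_,
    fun q _ i hi y z hy hz => pastClass_shiftBelow fun k hk => ?_⟩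
  · by_cases h1 : m + M ≤ i
    · exact shiftBelow_of_prepend_drop h1 _ hq
    · by_cases h2 : i ≤ m
      · exact key q i h2 0 (Nat.zero_le L) (x.2 i)
      · refine LexLE.of_bot (n := 1) (fun j hj => ?_) ⟨0, one_pos, h0⟩
        exact hpre' q _ (by omega) (by omega)
  · rw [funext hy, funext hz]
    refine ⟨fun h => ?_, key q i (by omega) k hk⟩
    by_contra h'
    obtain ⟨r, hrm, hr, hr'⟩ := hm i (Finset.mem_range.2 (by omega)) k
      (Finset.mem_range.2 (by omega)) h'
    refine (h r fun j hj => ?_).not_gt ?_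
    · exact (hpre q _ (by omega)).trans (hr j hj)
    · change ξ (r + k) < pre (m + M) c q (r + i)
      rwa [hpre q _ hrm]

end ShiftBelow

/-! ## The sequence `ξ_β` -/

/-- Every prefix of the lexicographic supremum of a set is a prefix of an element of the set. -/
theorem exists_agree_of_isLUB {N : ℕ} {E : Set (Lex (ℕ → Fin N))} {ξ : Lex (ℕ → Fin N)}
    (h : IsLUB E ξ) (hne : E.Nonempty) (n : ℕ) :
    ∃ e ∈ E, ∀ j < n, ofLex e j = ofLex ξ j := by
  induction n with
  | zero => exact ⟨_, hne.some_mem, fun j hj => absurd hj (Nat.not_lt_zero j)⟩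
  | succ n ih =>
    by_contra! hcon
    have hlt : ∀ e ∈ E, (∀ j < n, ofLex e j = ofLex ξ j) → ofLex e n < ofLex ξ n := by
      intro e he hen
      refine lt_of_le_of_ne (toLex_le_toLex_iff.1 (h.1 he) n hen) fun hn => ?_
      obtain ⟨j, hj, hj'⟩ := hcon e he
      rcases Nat.lt_succ_iff_lt_or_eq.1 hj with hj | rfl
      · exact hj' (hen j hj)
      · exact hj' hn
    obtain ⟨e₀, he₀, hen₀⟩ := ih
    have hpos := hlt e₀ he₀ hen₀
    -- If no element of `E` matches `ξ` through position `n`, then lowering `ξ n` by one and filling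
    -- up with the largest letter gives an upper bound below `ξ`.
    set b : ℕ → Fin N := fun t => if t < n then ofLex ξ t else if t = n then
      ⟨ofLex ξ n - 1, by omega⟩ else ⟨N - 1, by have := (ofLex ξ n).2; omega⟩ with hb
    have hbn : b n < ofLex ξ n := by
      simp only [hb, lt_irrefl, if_false, if_true]
      rw [Fin.lt_def] at hpos ⊢
      simp only
      omega
    have hble : ∀ j < n, b j = ofLex ξ j := fun j hj => if_pos hj
    have hub : toLex b ∈ upperBounds E := by
      intro e he
      refine (toLex_le_toLex_iff (x := ofLex e) (y := b)).2 fun i hi => ?_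
      rcases lt_trichotomy i n with hin | rfl | hin
      · rw [hble i hin]
        exact toLex_le_toLex_iff.1 (h.1 he) i fun j hj =>
          (hi j hj).trans (hble j (hj.trans hin))
      · have := hlt e he fun j hj => (hi j hj).trans (hble j hj)
        simp only [hb, lt_irrefl, if_false, if_true]
        rw [Fin.lt_def] at this
        rw [Fin.le_def]
        simp only
        omega
      · simp only [hb, not_lt.2 hin.le, hin.ne', if_false]
        rw [Fin.le_def]
        have := (ofLex e i).2
        simp only
        omega
    exact (toLex_le_toLex_iff.1 (h.2 hub) n fun j hj => (hble j hj).symm).not_gt hbn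

/-! ### Expansions of real numbers and the two properties of `ξ_β` -/

section Beta

variable {β : ℝ}

theorem betaMap_iterate_mem {x : ℝ} (hx : x ∈ Ico (0 : ℝ) 1) (n : ℕ) :
    (betaMap β)^[n] x ∈ Ico (0 : ℝ) 1 := by
  cases n with
  | zero => exact hx
  | succ n =>
    rw [Function.iterate_succ_apply']
    exact ⟨Int.fract_nonneg _, Int.fract_lt_one _⟩

theorem digit_add (x : ℝ) (n m : ℕ) : digit β x (n + m) = digit β ((betaMap β)^[m] x) n := by
  rw [digit, digit, Function.iterate_add_apply]

variable [hβ : Fact (1 < β)]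

theorem digit_lt {x : ℝ} (hx : x ∈ Ico (0 : ℝ) 1) (n : ℕ) : digit β x n < ⌈β⌉₊ := by
  have h1 := hβ.out
  have h := betaMap_iterate_mem (β := β) hx n
  rw [digit, Nat.floor_lt (mul_nonneg (by linarith) h.1)]
  exact lt_of_lt_of_le (by nlinarith [h.2]) (Nat.le_ceil β)

/-- The `β`-expansion of a point of `[0, 1)`. -/
def expansion (β : ℝ) [Fact (1 < β)] {x : ℝ} (hx : x ∈ Ico (0 : ℝ) 1) : ℕ → Alphabet β :=
  fun n => ⟨digit β x n, digit_lt hx n⟩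

theorem expansion_mem {x : ℝ} (hx : x ∈ Ico (0 : ℝ) 1) : toLex (expansion β hx) ∈ expansions β :=
  ⟨x, hx, fun _ => rfl⟩

theorem betaMap_iterate_succ_eq {x : ℝ} (hx : x ∈ Ico (0 : ℝ) 1) (n : ℕ) :
    (betaMap β)^[n + 1] x = β * (betaMap β)^[n] x - digit β x n := by
  have h1 := hβ.out
  rw [Function.iterate_succ_apply', betaMap, digit, ← Int.self_sub_floor,
    natCast_floor_eq_intCast_floor (mul_nonneg (by linarith) (betaMap_iterate_mem hx n).1)]

theorem betaMap_iterate_sub {x y : ℝ} (hx : x ∈ Ico (0 : ℝ) 1) (hy : y ∈ Ico (0 : ℝ) 1) (n : ℕ)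
    (h : ∀ j < n, digit β x j = digit β y j) :
    (betaMap β)^[n] y - (betaMap β)^[n] x = β ^ n * (y - x) := by
  induction n with
  | zero => simp
  | succ n ih =>
    rw [betaMap_iterate_succ_eq hx, betaMap_iterate_succ_eq hy, h n n.lt_succ_self, pow_succ']
    linear_combination β * ih fun j hj => h j (hj.trans n.lt_succ_self)

/-- Common digits stretch `y - x` by `β^n`, which cannot stay below 1, so some digits differ. At the
first difference the iterates are still in the order of `x < y`, and so are their digits. -/
theorem expansion_lt {x y : ℝ} (hx : x ∈ Ico (0 : ℝ) 1) (hy : y ∈ Ico (0 : ℝ) 1) (hxy : x < y) :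
    ¬ LexLE (expansion β hy) (expansion β hx) := by
  have h1 := hβ.out
  have hne : ∃ n, digit β x n ≠ digit β y n := by
    by_contra! h
    obtain ⟨n, hn⟩ := pow_unbounded_of_one_lt (1 / (y - x)) h1
    have h2 := betaMap_iterate_sub hx hy n fun j _ => h j
    have h3 := (betaMap_iterate_mem (β := β) hx n).1
    have h4 := (betaMap_iterate_mem (β := β) hy n).2
    rw [div_lt_iff₀ (sub_pos.2 hxy)] at hn
    linarith
  intro h
  classical
  have hmin : ∀ j < Nat.find hne, digit β x j = digit β y j := fun j hj =>
    not_not.1 (Nat.find_min hne hj)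
  have h2 : digit β y (Nat.find hne) ≤ digit β x (Nat.find hne) :=
    h (Nat.find hne) fun j hj => Fin.ext (hmin j hj).symm
  refine Nat.find_spec hne (le_antisymm (Nat.floor_le_floor ?_) h2)
  have h3 := betaMap_iterate_sub hx hy _ hmin
  have h4 : 0 < β ^ Nat.find hne * (y - x) := mul_pos (by positivity) (sub_pos.2 hxy)
  exact mul_le_mul_of_nonneg_left (by linarith) (by linarith)

theorem isLUB_xi : IsLUB (expansions β) (xi β) := isLUB_sSup _

theorem lexLE_xi {x : ℝ} (hx : x ∈ Ico (0 : ℝ) 1) : LexLE (expansion β hx) (ofLex (xi β)) :=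
  toLex_le_toLex_iff.1 (isLUB_xi.1 (expansion_mem hx))

theorem exists_expansion_agree (n : ℕ) : ∃ (x : ℝ) (hx : x ∈ Ico (0 : ℝ) 1),
    ∀ j < n, expansion β hx j = ofLex (xi β) j := by
  obtain ⟨e, ⟨x, hx, hex⟩, he⟩ := exists_agree_of_isLUB (isLUB_xi (β := β))
    ⟨_, expansion_mem (left_mem_Ico.2 one_pos)⟩ n
  exact ⟨x, hx, fun j hj => (Fin.ext (hex j).symm).trans (he j hj)⟩

/-- A finite piece of a tail of `ξ_β` occurs in a tail of an expansion, which is the expansion of an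
iterate and hence at most `ξ_β`. -/
theorem xi_mem : ofLex (xi β) ∈ shiftBelow (ofLex (xi β)) := by
  intro m i hi
  obtain ⟨x, hx, h⟩ := exists_expansion_agree (β := β) (i + 1 + m)
  have hy := betaMap_iterate_mem (β := β) hx m
  have hxy : ∀ t < i + 1, expansion β hy t = ofLex (xi β) (t + m) := fun t ht =>
    (Fin.ext (digit_add x t m).symm).trans (h (t + m) (by omega))
  simp only [← hxy i i.lt_succ_self]
  exact lexLE_xi (β := β) hy i fun j hj => (hxy j (by omega)).trans (hi j hj)

theorem xi_not_eventually_zero (m : ℕ) : ∃ t, ofLex (xi β) (t + m) ≠ 0 := by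
  by_contra! h
  obtain ⟨x, hx, hxm⟩ := exists_expansion_agree (β := β) m
  have hx1 := hx.2
  -- Any point strictly between `x` and 1 serves. Its expansion is at most `ξ_β`, which is at most
  -- the expansion of `x` if `ξ_β` vanishes from `m` on; this contradicts monotonicity.
  have hy : (x + 1) / 2 ∈ Ico (0 : ℝ) 1 := ⟨by linarith [hx.1], by linarith⟩
  refine expansion_lt (β := β) hx hy (by linarith) (toLex_le_toLex_iff.1
    ((toLex_le_toLex_iff.2 (lexLE_xi hy)).trans (toLex_le_toLex_iff.2 fun i _ => ?_)))
  by_cases hi : i < m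
  · exact (hxm i hi).ge
  · have := h (i - m)
    rw [Nat.sub_add_cancel (not_lt.1 hi)] at this
    rw [this]
    exact Fin.zero_le _

theorem betaShift_eq : betaShift β = shiftBelow (ofLex (xi β)) :=
  Set.ext fun _ => forall_congr' fun _ => toLex_le_toLex_iff

theorem isPadded_betaShift : IsPadded (betaShift β) :=
  betaShift_eq (β := β) ▸ isPadded_shiftBelow (head_ne_bot xi_mem xi_not_eventually_zero)

theorem finite_vertex_betaShift (l : ℕ) : Finite (Vertex (betaShift β) l) :=
  betaShift_eq (β := β) ▸ finite_vertex_shiftBelow l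

theorem hasFullExtensions_betaShift : HasFullExtensions (betaShift β) :=
  betaShift_eq (β := β) ▸ hasFullExtensions_shiftBelow
    (head_ne_bot xi_mem xi_not_eventually_zero) xi_not_eventually_zero

theorem exists_ne_betaShift (k l : ℕ) (hkl : k < l) : ∃ x ∈ betaShift β, x k ≠ x l :=
  betaShift_eq (β := β) ▸ exists_ne_of_lt xi_mem (head_ne_bot xi_mem xi_not_eventually_zero) hkl

end Beta

end BetaShift

end

theorem mainTheorem7 (β : ℝ) [Fact (1 < β)] :
    (BetaShift.betaGroupoid β).IsEtale ∧
    (BetaShift.betaGroupoid β).IsEssentiallyPrincipal ∧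
    (BetaShift.betaGroupoid β).IsPurelyInfinite ∧
    (BetaShift.betaGroupoid β).IsMinimal := by
  exact BetaShift.isPadded_betaShift.drGroupoid_pathShift BetaShift.finite_vertex_betaShift
    BetaShift.hasFullExtensions_betaShift BetaShift.exists_ne_betaShift
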